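/- **Setting.** Let $D$ be an open disc centred at the origin of $\mathbf C$. Let $V$ be a subharmonic function in $D$ (upper semicontinuous, with values in $[-\infty,\infty)$, not identically $-\infty$) such that $K=\operatorname{supp}(\Delta V)$, the support in $D$ of its distributional Laplacian, has Lebesgue measure $0$. Suppose that $\partial V/\partial z=\tfrac12(\partial V/\partial x-i\,\partial V/\partial y)$ is piecewise holomorphic with respect to a $k$-tuple $g_1,\dots,g_k$ of holomorphic functions in $D$, i.e. for every connected component $\omega$ of $D\setminus K$ there is some $j$ with $\partial V/\partial z=g_j$ in $\omega$. Let $U_\nu$ be the union of those connected components of $D\setminus K$ in which $\partial V/\partial z=g_\nu$, let $H_\nu$ be the unique real-valued harmonic function in $D$ with $\partial H_\nu/\partial z=g_\nu$ and $H_\nu(0)=0$, and let $P$ be the convex hull of $g_1(0),\dots,g_k(0)$. **Theorem.** Let $1\le \ell\le k$. Suppose that $g_1(0),\dots,g_\ell(0)$ are distinct, that they are exactly the extreme points of $P$, labelled consecutively in counter-clockwise order, and that the origin belongs to the closure of $U_j$ for every $1\le j\le\ell$. Suppose further that for every $i\in\{\ell+1,\dots,k\}$ $$g_i(0)\notin\bigcup_{j=1}^{\ell}\{(1-\alpha)\,g_{[j]}(0)+\alpha\,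 g_{[j+1]}(0):0\le\alpha\le1\},$$ where $[j]=j$ for $1\le j\le\ell$ and $[\ell+1]=1$. Then there exist $c\in\mathbf R$ and a neighbourhood of the origin in which $$V=\max(H_1,\dots,H_\ell)+c .$$ -/

import Mathlib

open MeasureTheory Filter Topology Set
open scoped Laplacian Distributions

namespace SubharmonicConfiguration

noncomputable section

/-- The mean value in `[-∞, ∞]` of `V` over the circle of centre `z` and radius `r`: the mean of
the positive part minus the mean of the negative part. -/
def circleMean (V : ℂ → EReal) (z : ℂ) (r : ℝ) : EReal :=
  ((⨍⁻ θ in Ioc 0 (2 * Real.pi), (V (circleMap z r θ)).toENNReal ∂volume : ENNReal) : EReal) -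
    ((⨍⁻ θ in Ioc 0 (2 * Real.pi), (-V (circleMap z r θ)).toENNReal ∂volume : ENNReal) : EReal)

/-- `V` is a subharmonic function in the connected open set `Ω`: upper semicontinuous with values
in `[-∞, ∞)`, not identically `-∞`, and bounded by its mean over the boundary of every closed disc
in `Ω`. The values of `V` outside `Ω` are irrelevant. -/
structure IsSubharmonic (Ω : TopologicalSpace.Opens ℂ) (V : ℂ → EReal) : Prop where
  upperSemicontinuousOn : UpperSemicontinuousOn V Ω
  lt_top : ∀ z ∈ Ω, V z < ⊤
  exists_ne_bot : ∃ z ∈ Ω, V z ≠ ⊥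
  le_circleMean : ∀ z : ℂ, ∀ r : ℝ, 0 < r → Metric.closedBall z r ⊆ (Ω : Set ℂ) →
    V z ≤ circleMean V z r

/-- The Wirtinger derivative `∂f/∂z = (∂f/∂x - i ∂f/∂y) / 2` of a real-valued function. -/
def dz (f : ℂ → ℝ) (z : ℂ) : ℂ :=
  ((fderiv ℝ f z 1 : ℝ) - Complex.I * (fderiv ℝ f z Complex.I : ℝ)) / 2

/-- The Laplacian of `V` in `Ω` in the sense of distributions. A subharmonic function is locally
integrable, and finite almost everywhere, so `toReal` only changes `V` on a null set. -/
def distLaplacian (Ω : TopologicalSpace.Opens ℂ) (V : ℂ → EReal) (φ : 𝓓(Ω, ℝ)) : ℝ :=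
  ∫ z, (V z).toReal * (Δ (φ : ℂ → ℝ)) z

/-- The derivative `∂V/∂z` in `Ω` in the sense of distributions. -/
def distDz (Ω : TopologicalSpace.Opens ℂ) (V : ℂ → EReal) (φ : 𝓓(Ω, ℝ)) : ℂ :=
  -∫ z, ((V z).toReal : ℂ) * dz φ z

/-- The support in `Ω` of the distribution `Δ V`. -/
def suppLaplacian (Ω : TopologicalSpace.Opens ℂ) (V : ℂ → EReal) : Set ℂ :=
  (Ω : Set ℂ) ∩ Distribution.dsupport (distLaplacian Ω V)

/-- The class `SH₀(Ω)` of subharmonic functions in `Ω` for which the support of the Laplacian has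
Lebesgue measure zero. -/
structure IsSH₀ (Ω : TopologicalSpace.Opens ℂ) (V : ℂ → EReal) : Prop where
  isSubharmonic : IsSubharmonic Ω V
  volume_suppLaplacian : volume (suppLaplacian Ω V) = 0

/-- `∂V/∂z = g` on the set `U`, in the sense of distributions. -/
def DzEqOn (Ω : TopologicalSpace.Opens ℂ) (V : ℂ → EReal) (g : ℂ → ℂ) (U : Set ℂ) : Prop :=
  Distribution.IsVanishingOn
    (fun φ : 𝓓(Ω, ℝ) => distDz Ω V φ - ∫ z, g z * ((φ z : ℝ) : ℂ)) U

/-- The union of those connected components of `Ω \ supp (Δ V)` on which `∂V/∂z = g`. -/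
def activeSet (Ω : TopologicalSpace.Opens ℂ) (V : ℂ → EReal) (g : ℂ → ℂ) : Set ℂ :=
  {z | z ∈ (Ω : Set ℂ) \ suppLaplacian Ω V ∧
    DzEqOn Ω V g (connectedComponentIn ((Ω : Set ℂ) \ suppLaplacian Ω V) z)}

/-- `∂V/∂z` is piecewise holomorphic with respect to `g₁, …, g_k`: these functions are holomorphic
in `Ω`, and on every connected component of `Ω \ supp (Δ V)` one of them equals `∂V/∂z`. -/
structure IsPiecewiseHolomorphicDz (Ω : TopologicalSpace.Opens ℂ) (V : ℂ → EReal) {k : ℕ}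
    (g : Fin k → ℂ → ℂ) : Prop where
  holomorphic : ∀ i, DifferentiableOn ℂ (g i) Ω
  exists_eq : ∀ z ∈ (Ω : Set ℂ) \ suppLaplacian Ω V, ∃ i,
    DzEqOn Ω V (g i) (connectedComponentIn ((Ω : Set ℂ) \ suppLaplacian Ω V) z)

/-- The open disc of radius `R` centred at the origin. -/
def disc (R : ℝ) : TopologicalSpace.Opens ℂ := ⟨Metric.ball 0 R, Metric.isOpen_ball⟩

/-- The points `v₁, …, v_ℓ` are distinct and are listed consecutively, in counter-clockwise order,
along the boundary of a convex polygon of which they are the vertices: every `v i` other than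
`v j` and its cyclic successor lies strictly to the left of the directed line from `v j` to this
successor. -/
def IsCounterclockwise {ℓ : ℕ} (v : Fin ℓ → ℂ) : Prop :=
  Function.Injective v ∧ ∀ j i, i ≠ j → i ≠ finRotate ℓ j →
    0 < ((starRingEnd ℂ) (v (finRotate ℓ j) - v j) * (v i - v j)).im

end

end SubharmonicConfiguration

/-! Off `K` the function `V` is locally some `H i + c`, so its gradient is bounded there. But `K` is
only known to be a null set, and bounds off a null set say nothing about jumps across it. The first
half of the proof excludes jumps: near the origin `V` is Lipschitz (`exists_lipschitz`). For `E =
exp V` the sub-mean value inequality gives a discrete Caccioppoli estimate: the integral of `|E(z+v)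
- E(z)|²` over `|z| < 2ρ`, `|v| < r` is `O(r²)` times the area of the disc of radius `r`
(`exists_lintegral_sq_sub_le`). A displacement `h` is cut into `n` equal steps. Steps starting away
from `K` obey the gradient bound; those starting near `K` are controlled by the energy and by the
area of a shrinking neighbourhood of `K`. In the limit `E(z+h) ≤ exp(L|h|) E(z)` almost everywhere
(`ae_le_exp_mul_of_energy`), and semicontinuity with the sub-mean value inequality makes this hold
everywhere. From then on, `V` can be recovered by integrating its derivative along almost every
segment, ignoring `K` (`le_of_deriv_segment_nonpos`).

Lower bound (`eventually_harmonic_le`). At a vertex `g j 0` of the polygon some direction `e` makes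
`Re (g j 0 * e)` strictly larger than all the other `Re (g i 0 * e)`. Near the origin `V - H j` is
therefore nonincreasing in every direction of a cone around `e`. At a point where `g j` is active `V
- H j` is locally constant, and the strong maximum principle carries the constant along the cone to
a point lying ahead of every point of a fixed neighbourhood of the origin. So the constant is the
minimum of `V - H j` there. As active points accumulate at the origin, `V ≥ H j + V 0`, with
equality where `g j` is active.

Upper bound. Let `M` be the maximum of the `H j` over the vertices. Where a vertex is active, the
lower bound forces `V - M` to be the constant `V 0`. Elsewhere the active `g i 0` lies in the
polygon off its edges, so the radial derivative of `H i` is at most that of a largest `H j`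
(`eventually_radial_le`). Hence `V - M` does not increase along rays from the origin. -/

namespace SubharmonicConfiguration

/-! ### Sub-mean value inequality: from circles to discs -/

/-- Integration over a disc in polar coordinates. -/
theorem lintegral_ball_eq_lintegral_circle {F : ℂ → ENNReal} (hF : Measurable F) (z : ℂ) (r : ℝ) :
    ∫⁻ w in Metric.ball z r, F w =
      ∫⁻ s in Ioo 0 r, ENNReal.ofReal s * ∫⁻ θ in Ioc 0 (2 * Real.pi), F (circleMap z s θ) := by
  set G : ℂ → ENNReal := (Metric.ball z r).indicator F with hG
  have hGm : Measurable G := hF.indicator Metric.isOpen_ball.measurableSet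
  -- Polar coordinates use angles in `(-π, π)`. Writing the point as `z - w` rather than `z + w`
  -- adds `π` to the angle, which lands exactly in the interval `(0, 2π]` used by the circle means.
  have hshift : ∀ s : ℝ, ∫⁻ θ in Ioo (-Real.pi) Real.pi, G (z - Complex.polarCoord.symm (s, θ)) =
      ∫⁻ θ in Ioc 0 (2 * Real.pi), G (circleMap z s θ) := by
    intro s
    rw [setLIntegral_congr Ioo_ae_eq_Ioc]
    rw [← lintegral_indicator measurableSet_Ioc, ← lintegral_indicator measurableSet_Ioc,
      ← lintegral_add_right_eq_self ((Ioc 0 (2 * Real.pi)).indicator _) Real.pi]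
    congr 1
    ext θ
    have h1 : θ ∈ Ioc (-Real.pi) Real.pi ↔ θ + Real.pi ∈ Ioc 0 (2 * Real.pi) := by
      simp only [mem_Ioc]; constructor <;> rintro ⟨h1, h2⟩ <;> constructor <;> linarith
    have h2 : z - Complex.polarCoord.symm (s, θ) = circleMap z s (θ + Real.pi) := by
      rw [Complex.polarCoord_symm_apply, circleMap]
      push_cast
      rw [add_mul, Complex.exp_add, Complex.exp_pi_mul_I, Complex.exp_mul_I]
      ring
    by_cases h : θ ∈ Ioc (-Real.pi) Real.pi
    · rw [indicator_of_mem h, indicator_of_mem (h1.1 h), h2]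
    · rw [indicator_of_notMem h, indicator_of_notMem (fun h' => h (h1.2 h'))]
  have hmeas : Measurable fun p : ℝ × ℝ => ENNReal.ofReal p.1 *
      G (z - Complex.polarCoord.symm p) := by
    have : Measurable fun p : ℝ × ℝ => Complex.polarCoord.symm p := by
      simp only [Complex.polarCoord_symm_apply]
      fun_prop
    exact (by fun_prop : Measurable fun p : ℝ × ℝ => ENNReal.ofReal p.1).mul
      (hGm.comp (measurable_const.sub this))
  rw [← lintegral_indicator Metric.isOpen_ball.measurableSet, ← lintegral_sub_left_eq_self _ z,
    ← Complex.lintegral_comp_polarCoord_symm]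
  simp only [polarCoord_target, smul_eq_mul]
  rw [Measure.volume_eq_prod, ← Measure.prod_restrict, lintegral_prod _ hmeas.aemeasurable,
    ← lintegral_indicator measurableSet_Ioi, ← lintegral_indicator measurableSet_Ioo]
  congr 1
  ext s
  by_cases hs0 : 0 < s
  · rw [indicator_of_mem (show s ∈ Ioi 0 from hs0), lintegral_const_mul' _ _ ENNReal.ofReal_ne_top,
      hshift s]
    have hd : ∀ θ, circleMap z s θ ∈ Metric.ball z r ↔ s < r := by
      intro θ
      simp [circleMap, abs_of_pos hs0]
    by_cases hsr : s < r
    · rw [indicator_of_mem (show s ∈ Ioo 0 r from ⟨hs0, hsr⟩)]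
      congr 2
      ext θ
      rw [hG, indicator_of_mem ((hd θ).2 hsr)]
    · rw [indicator_of_notMem (fun h : s ∈ Ioo 0 r => hsr h.2)]
      simp [hG, hd, hsr]
  · rw [indicator_of_notMem (show s ∉ Ioi 0 from hs0),
      indicator_of_notMem (fun h : s ∈ Ioo 0 r => hs0 h.1)]

/-- The identity `(C - x) + x⁺ = C + x⁻`, free of subtraction on `[0, ∞]` and valid also for `x =
-∞`. It trades the difference of two means in `circleMean` for the mean of a single nonnegative
function. -/
theorem EReal_sub_toENNReal_add {x : EReal} {C : ℝ} (hC : 0 ≤ C) (hx : x ≤ C) :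
    ((C : EReal) - x).toENNReal + x.toENNReal = ENNReal.ofReal C + (-x).toENNReal := by
  induction x with
  | bot => simp
  | top => simp at hx
  | coe y =>
    have hy : y ≤ C := by exact_mod_cast hx
    rw [← EReal.coe_sub, ← EReal.coe_neg, EReal.toENNReal_of_ne_top (EReal.coe_ne_top _),
      EReal.toENNReal_of_ne_top (EReal.coe_ne_top _), EReal.toENNReal_of_ne_top (EReal.coe_ne_top _)]
    simp only [EReal.toReal_coe]
    rcases le_total 0 y with h | h
    · rw [ENNReal.ofReal_of_nonpos (show -y ≤ 0 by linarith), add_zero,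
        ← ENNReal.ofReal_add (by linarith) h]
      congr 1; ring
    · rw [ENNReal.ofReal_of_nonpos h, add_zero, ← ENNReal.ofReal_add hC (by linarith)]
      congr 1

/-- If `V ≤ C` on a circle then the sub-mean value inequality for `V` gives the super-mean value
inequality for the nonnegative function `C - V`. -/
theorem lintegral_circle_sub_le {V : ℂ → EReal} (hVm : Measurable V) {z : ℂ} {r C : ℝ}
    (hC : 0 ≤ C) (hVC : ∀ θ, V (circleMap z r θ) ≤ C) (hz : V z ≤ C)
    (hV : V z ≤ circleMean V z r) :
    ∫⁻ θ in Ioc 0 (2 * Real.pi), ((C : EReal) - V (circleMap z r θ)).toENNReal ≤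
      ∫⁻ _θ in Ioc 0 (2 * Real.pi), ((C : EReal) - V z).toENNReal := by
  have hcm : Measurable fun θ => V (circleMap z r θ) :=
    hVm.comp (continuous_circleMap z r).measurable
  have hvol : volume (Ioc 0 (2 * Real.pi)) ≠ 0 := by
    simp [Real.pi_pos]
  have hvol' : volume (Ioc 0 (2 * Real.pi)) ≠ ⊤ := measure_Ioc_lt_top.ne
  set n := ⨍⁻ θ in Ioc 0 (2 * Real.pi), ((C : EReal) - V (circleMap z r θ)).toENNReal ∂volume with hn
  set p := ⨍⁻ θ in Ioc 0 (2 * Real.pi), (V (circleMap z r θ)).toENNReal ∂volume with hp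
  set q := ⨍⁻ θ in Ioc 0 (2 * Real.pi), (-V (circleMap z r θ)).toENNReal ∂volume with hq
  have hadd : n + p = ENNReal.ofReal C + q := by
    rw [hn, hp, hq, setLAverage_eq, setLAverage_eq, setLAverage_eq, ENNReal.div_add_div_same,
      ← lintegral_add_right _ hcm.ereal_toENNReal]
    have : ENNReal.ofReal C = (∫⁻ _θ in Ioc 0 (2 * Real.pi), ENNReal.ofReal C) /
        volume (Ioc 0 (2 * Real.pi)) := by
      rw [setLIntegral_const, ENNReal.mul_div_cancel_right hvol hvol']
    conv_rhs => rw [this]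
    rw [ENNReal.div_add_div_same, ← lintegral_add_left measurable_const]
    congr 1
    exact lintegral_congr fun θ => EReal_sub_toENNReal_add hC (hVC θ)
  have hpC : p ≤ ENNReal.ofReal C := by
    rw [hp, setLAverage_eq]
    refine ENNReal.div_le_of_le_mul ?_
    rw [← setLIntegral_const]
    refine lintegral_mono fun θ => ?_
    have := EReal.toENNReal_le_toENNReal (hVC θ)
    rwa [EReal.toENNReal_of_ne_top (EReal.coe_ne_top _)] at this
  have hptop : p ≠ ⊤ := ne_top_of_le_ne_top ENNReal.ofReal_ne_top hpC
  have hle : n ≤ ((C : EReal) - V z).toENNReal := by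
    have hV' : V z ≤ (p : EReal) - (q : EReal) := hV
    -- An infinite mean of the negative part forces `V z = ⊥`, and then the right-hand side is
    -- infinite.
    by_cases hqt : q = ⊤
    · rw [hqt, EReal.coe_ennreal_top, EReal.sub_top, le_bot_iff] at hV'
      rw [hV']; simp
    have hnt : n ≠ ⊤ := by
      have : n + p ≠ ⊤ := by rw [hadd]; exact ENNReal.add_ne_top.2 ⟨ENNReal.ofReal_ne_top, hqt⟩
      exact (ENNReal.add_ne_top.1 this).1
    have hreal : n.toReal + p.toReal = C + q.toReal := by
      have := congrArg ENNReal.toReal hadd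
      rwa [ENNReal.toReal_add hnt hptop, ENNReal.toReal_add ENNReal.ofReal_ne_top hqt,
        ENNReal.toReal_ofReal hC] at this
    cases hVz : V z with
    | bot => simp
    | top => rw [hVz] at hz; simp at hz
    | coe y =>
      rw [hVz, ← EReal.coe_ennreal_toReal hptop, ← EReal.coe_ennreal_toReal hqt,
        ← EReal.coe_sub, EReal.coe_le_coe_iff] at hV'
      rw [← EReal.coe_sub, EReal.toENNReal_of_ne_top (EReal.coe_ne_top _), EReal.toReal_coe,
        ← ENNReal.ofReal_toReal hnt]
      exact ENNReal.ofReal_le_ofReal (by linarith)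
  rw [hn, setLAverage_eq] at hle
  rw [setLIntegral_const]
  exact (ENNReal.div_le_iff hvol hvol').1 hle

end SubharmonicConfiguration

/-! ### Local integrability of subharmonic functions -/

namespace SubharmonicConfiguration

/-- The values of `V` off `Ω` are arbitrary, so `V` itself need not be measurable. Replacing them by
`⊤` keeps upper semicontinuity, since nothing exceeds `⊤`. -/
theorem exists_measurable_eqOn {Ω : TopologicalSpace.Opens ℂ} {V : ℂ → EReal}
    (hV : UpperSemicontinuousOn V Ω) : ∃ V₀ : ℂ → EReal, Measurable V₀ ∧ EqOn V₀ V Ω := by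
  classical
  refine ⟨(Ω : Set ℂ).piecewise V fun _ => ⊤, ?_, fun z hz => piecewise_eq_of_mem _ _ _ hz⟩
  refine UpperSemicontinuous.measurable fun z a ha => ?_
  beta_reduce at ha ⊢
  by_cases hz : z ∈ (Ω : Set ℂ)
  · rw [piecewise_eq_of_mem _ _ _ hz] at ha
    have := hV z hz a ha
    rw [Ω.isOpen.nhdsWithin_eq hz] at this
    filter_upwards [this, Ω.isOpen.mem_nhds hz] with w hw hwΩ
    rwa [piecewise_eq_of_mem _ _ _ hwΩ]
  · rw [piecewise_eq_of_notMem _ _ _ hz] at ha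
    exact absurd ha not_top_lt

variable {Ω : TopologicalSpace.Opens ℂ} {V : ℂ → EReal}

theorem IsSubharmonic.exists_bound (hV : IsSubharmonic Ω V) {s : Set ℂ} (hs : IsCompact s)
    (hsΩ : s ⊆ Ω) : ∃ C : ℝ, 0 ≤ C ∧ ∀ z ∈ s, V z ≤ C := by
  rcases s.eq_empty_or_nonempty with rfl | hne
  · exact ⟨0, le_rfl, by simp⟩
  obtain ⟨a, ha, hmax⟩ := (hV.upperSemicontinuousOn.mono hsΩ).exists_isMaxOn hne hs
  refine ⟨max 0 (V a).toReal, le_max_left _ _, fun z hz => (hmax hz).trans ?_⟩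
  refine (EReal.le_coe_toReal (hV.lt_top a (hsΩ ha)).ne).trans ?_
  exact_mod_cast le_max_right _ _

/-- The circle inequalities are integrated in polar coordinates. Working with `C - V ≥ 0` keeps
everything in `[0, ∞]`, so no integrability is presupposed; it is a consequence as soon as `V z ≠
⊥`. -/
theorem IsSubharmonic.lintegral_ball_sub_le (hV : IsSubharmonic Ω V) {z : ℂ} {r C : ℝ}
    (hr : 0 < r) (hC : 0 ≤ C) (hVC : ∀ w ∈ Metric.closedBall z r, V w ≤ C)
    (hsub : Metric.closedBall z r ⊆ (Ω : Set ℂ)) :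
    ∫⁻ w in Metric.ball z r, ((C : EReal) - V w).toENNReal ≤
      volume (Metric.ball z r) * ((C : EReal) - V z).toENNReal := by
  obtain ⟨V₀, hm, heq⟩ := exists_measurable_eqOn hV.upperSemicontinuousOn
  have hzr : z ∈ Metric.closedBall z r := Metric.mem_closedBall_self hr.le
  have h1 : ∫⁻ w in Metric.ball z r, ((C : EReal) - V w).toENNReal =
      ∫⁻ w in Metric.ball z r, ((C : EReal) - V₀ w).toENNReal :=
    setLIntegral_congr_fun Metric.isOpen_ball.measurableSet fun w hw => by
      rw [heq (hsub (Metric.ball_subset_closedBall hw))]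
  have h2 : volume (Metric.ball z r) * ((C : EReal) - V z).toENNReal =
      ∫⁻ w in Metric.ball z r, ((C : EReal) - V z).toENNReal := by
    rw [setLIntegral_const, mul_comm]
  have hm' : Measurable fun w => ((C : EReal) - V₀ w).toENNReal := by
    have : Measurable fun w => (C : EReal) - V₀ w := by
      simp only [sub_eq_add_neg]
      exact measurable_const.add hm.neg
    exact this.ereal_toENNReal
  rw [h1, h2, lintegral_ball_eq_lintegral_circle hm',
    lintegral_ball_eq_lintegral_circle measurable_const]
  refine setLIntegral_mono' measurableSet_Ioo fun s hs => ?_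
  gcongr ENNReal.ofReal s * ?_
  have hcs : ∀ θ, circleMap z s θ ∈ Metric.closedBall z r := fun θ =>
    Metric.closedBall_subset_closedBall hs.2.le (circleMap_mem_closedBall z hs.1.le θ)
  have hmean : circleMean V z s = circleMean V₀ z s := by
    unfold circleMean
    simp only [heq (hsub (hcs _))]
  have hz := heq (hsub hzr)
  have := lintegral_circle_sub_le hm (z := z) (r := s) hC
    (fun θ => by rw [heq (hsub (hcs θ))]; exact hVC _ (hcs θ)) (by rw [hz]; exact hVC z hzr)
    (by rw [hz, ← hmean]; exact hV.le_circleMean z s hs.1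
          ((Metric.closedBall_subset_closedBall hs.2.le).trans hsub))
  rwa [hz] at this

/-- The sub-mean value inequality over discs. -/
theorem IsSubharmonic.ball_submean (hV : IsSubharmonic Ω V) {z : ℂ} {r : ℝ}
    (hr : 0 < r) (hsub : Metric.closedBall z r ⊆ (Ω : Set ℂ)) (hz : V z ≠ ⊥) :
    (∀ᵐ w ∂volume.restrict (Metric.ball z r), V w ≠ ⊥) ∧
      IntegrableOn (fun w => (V w).toReal) (Metric.ball z r) ∧
      volume.real (Metric.ball z r) * (V z).toReal ≤ ∫ w in Metric.ball z r, (V w).toReal := by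
  obtain ⟨C, hC, hVC⟩ := hV.exists_bound (isCompact_closedBall z r) hsub
  obtain ⟨V₀, hm, heq⟩ := exists_measurable_eqOn hV.upperSemicontinuousOn
  have hzr : z ∈ Metric.closedBall z r := Metric.mem_closedBall_self hr.le
  have key := hV.lintegral_ball_sub_le hr hC hVC hsub
  set N : ℂ → ENNReal := fun w => ((C : EReal) - V w).toENNReal with hN
  have hN' : ∀ w ∈ Metric.closedBall z r, V w ≠ ⊥ → N w = ENNReal.ofReal (C - (V w).toReal) ∧
      (V w).toReal ≤ C := by
    intro w hw hb
    have h1 := hVC w hw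
    simp only [hN]
    cases hw' : V w with
    | bot => exact absurd hw' hb
    | top => rw [hw'] at h1; simp at h1
    | coe y =>
      rw [hw'] at h1
      rw [← EReal.coe_sub, EReal.toENNReal_of_ne_top (EReal.coe_ne_top _), EReal.toReal_coe]
      exact ⟨rfl, by exact_mod_cast h1⟩
  have hNm : AEMeasurable N (volume.restrict (Metric.ball z r)) := by
    refine ⟨fun w => ((C : EReal) - V₀ w).toENNReal, ?_, ?_⟩
    · have : Measurable fun w => (C : EReal) - V₀ w := by
        simp only [sub_eq_add_neg]
        exact measurable_const.add hm.neg
      exact this.ereal_toENNReal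
    · filter_upwards [ae_restrict_mem Metric.isOpen_ball.measurableSet] with w hw
      simp only [hN]
      rw [heq (hsub (Metric.ball_subset_closedBall hw))]
  obtain ⟨hNz, hzC⟩ := hN' z hzr hz
  have hfin : ∫⁻ w in Metric.ball z r, N w ≠ ⊤ := by
    refine ne_top_of_le_ne_top ?_ key
    change _ * N z ≠ ⊤
    rw [hNz]
    exact ENNReal.mul_ne_top measure_ball_lt_top.ne ENNReal.ofReal_ne_top
  have hae : ∀ᵐ w ∂volume.restrict (Metric.ball z r), V w ≠ ⊥ := by
    filter_upwards [ae_lt_top' hNm hfin] with w hw hb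
    simp [hN, hb] at hw
  have hfe : (fun w => (V w).toReal) =ᵐ[volume.restrict (Metric.ball z r)]
      fun w => C - (N w).toReal := by
    filter_upwards [hae, ae_restrict_mem Metric.isOpen_ball.measurableSet] with w hw hwb
    obtain ⟨h1, h2⟩ := hN' w (Metric.ball_subset_closedBall hwb) hw
    rw [h1, ENNReal.toReal_ofReal (by linarith)]
    ring
  have hNi : Integrable (fun w => (N w).toReal) (volume.restrict (Metric.ball z r)) :=
    integrable_toReal_of_lintegral_ne_top hNm hfin
  have hci : Integrable (fun _ : ℂ => C) (volume.restrict (Metric.ball z r)) :=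
    integrableOn_const measure_ball_lt_top.ne
  refine ⟨hae, (hci.sub hNi).congr hfe.symm, ?_⟩
  rw [integral_congr_ae hfe, integral_sub hci hNi, setIntegral_const, smul_eq_mul,
    integral_toReal hNm (ae_lt_top' hNm hfin)]
  have h3 := ENNReal.toReal_mono (by
    change _ * N z ≠ ⊤
    rw [hNz]
    exact ENNReal.mul_ne_top measure_ball_lt_top.ne ENNReal.ofReal_ne_top) key
  change _ ≤ (_ * N z).toReal at h3
  rw [hNz, ENNReal.toReal_mul, ENNReal.toReal_ofReal (by linarith)] at h3
  have : volume.real (Metric.ball z r) = (volume (Metric.ball z r)).toReal := rfl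
  rw [this]
  nlinarith [h3]

/-- A subharmonic function in a connected open set is locally integrable and finite almost
everywhere. -/
theorem IsSubharmonic.exists_ball_integrableOn (hV : IsSubharmonic Ω V)
    (hΩ : IsPreconnected (Ω : Set ℂ)) {z : ℂ} (hz : z ∈ Ω) :
    ∃ r > 0, (∀ᵐ w ∂volume.restrict (Metric.ball z r), V w ≠ ⊥) ∧
      IntegrableOn (fun w => (V w).toReal) (Metric.ball z r) := by
  -- The union of the discs centred at points where `V` is finite is open, and relatively closed:
  -- `V` is finite almost everywhere in such a disc, so a centre can be chosen close to any limit
  -- point. By connectedness it covers `Ω`.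
  set u : Set ℂ := {z | ∃ a r, V a ≠ ⊥ ∧ 0 < r ∧ Metric.closedBall a r ⊆ (Ω : Set ℂ) ∧
    z ∈ Metric.ball a r} with hu
  have huo : IsOpen u := by
    rw [isOpen_iff_mem_nhds]
    rintro y ⟨a, r, ha, hr, hsub, hy⟩
    filter_upwards [Metric.isOpen_ball.mem_nhds hy] with w hw
    exact ⟨a, r, ha, hr, hsub, hw⟩
  have hfin : ∀ y, V y ≠ ⊥ → y ∈ Ω → y ∈ u := by
    intro y hy hyΩ
    obtain ⟨r, hr, hsub⟩ := Metric.nhds_basis_closedBall.mem_iff.1 (Ω.isOpen.mem_nhds hyΩ)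
    exact ⟨y, r, hy, hr, hsub, Metric.mem_ball_self hr⟩
  have hsubset : (Ω : Set ℂ) ⊆ u := by
    refine hΩ.subset_of_closure_inter_subset huo ?_ ?_
    · obtain ⟨a, ha, ha'⟩ := hV.exists_ne_bot
      exact ⟨a, ha, hfin a ha' ha⟩
    · rintro y ⟨hy, hyΩ⟩
      obtain ⟨r, hr, hsub⟩ := Metric.nhds_basis_closedBall.mem_iff.1 (Ω.isOpen.mem_nhds hyΩ)
      obtain ⟨y', ⟨a, s, ha, hs, hsub', hy'a⟩, hy'⟩ := Metric.mem_closure_iff.1 hy (r / 4) (by linarith)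
      have hae := (hV.ball_submean hs hsub' ha).1
      have hopen : IsOpen (Metric.ball a s ∩ Metric.ball y (r / 4)) :=
        Metric.isOpen_ball.inter Metric.isOpen_ball
      have hne : (Metric.ball a s ∩ Metric.ball y (r / 4)).Nonempty :=
        ⟨y', hy'a, by rwa [Metric.mem_ball, dist_comm]⟩
      have hpos := hopen.measure_pos volume hne
      have hae' : ∀ᵐ w ∂volume.restrict (Metric.ball a s ∩ Metric.ball y (r / 4)), V w ≠ ⊥ :=
        ae_restrict_of_ae_restrict_of_subset inter_subset_left hae
      have : NeBot (ae (volume.restrict (Metric.ball a s ∩ Metric.ball y (r / 4)))) := by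
        rw [ae_neBot, Ne, Measure.restrict_eq_zero]
        exact hpos.ne'
      obtain ⟨b, hb, hbm⟩ := (hae'.and (ae_restrict_mem hopen.measurableSet)).exists
      refine ⟨b, r / 2, hb, by linarith, fun w hw => hsub ?_, ?_⟩
      · have h1 := hbm.2
        rw [Metric.mem_ball] at h1
        rw [Metric.mem_closedBall] at hw ⊢
        linarith [dist_triangle w b y]
      · have h1 := hbm.2
        rw [Metric.mem_ball, dist_comm] at h1
        rw [Metric.mem_ball]; linarith
  obtain ⟨a, r, ha, hr, hsub, hza⟩ := hsubset hz
  obtain ⟨s, hs, hss⟩ := Metric.isOpen_iff.1 Metric.isOpen_ball z hza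
  obtain ⟨h1, h2, -⟩ := hV.ball_submean hr hsub ha
  exact ⟨s, hs, ae_restrict_of_ae_restrict_of_subset hss h1, h2.mono_set hss⟩

theorem IsSubharmonic.ae_ne_bot (hV : IsSubharmonic Ω V)
    (hΩ : IsPreconnected (Ω : Set ℂ)) : ∀ᵐ w, w ∈ (Ω : Set ℂ) → V w ≠ ⊥ := by
  have : volume {w | w ∈ (Ω : Set ℂ) ∧ V w = ⊥} = 0 := by
    refine measure_null_of_locally_null _ fun z hz => ?_
    obtain ⟨r, hr, h, -⟩ := hV.exists_ball_integrableOn hΩ hz.1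
    rw [ae_restrict_iff' Metric.isOpen_ball.measurableSet, ae_iff] at h
    refine ⟨{w | w ∈ (Ω : Set ℂ) ∧ V w = ⊥} ∩ Metric.ball z r,
      inter_mem self_mem_nhdsWithin
        (mem_nhdsWithin_of_mem_nhds (Metric.ball_mem_nhds z hr)), measure_mono_null ?_ h⟩
    rintro w ⟨⟨-, h1⟩, h2⟩
    exact fun h => h h2 h1
  rw [ae_iff]
  convert this using 2
  ext w; simp

end SubharmonicConfiguration

/-! ### Vanishing distributional gradient; passing from almost everywhere to everywhere -/

namespace SubharmonicConfiguration

/-- A locally integrable function whose distributional gradient vanishes in a disc is almost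
everywhere constant in the concentric disc of half the radius. -/
theorem ae_eq_const_of_integral_fderiv_eq_zero {u : ℂ → ℝ} (hu : LocallyIntegrable u) {z : ℂ}
    {r : ℝ} (hr : 0 < r)
    (h : ∀ φ : ℂ → ℝ, ContDiff ℝ ((⊤ : ℕ∞) : WithTop ℕ∞) φ → HasCompactSupport φ →
      tsupport φ ⊆ Metric.ball z r →
      ∫ w, u w * fderiv ℝ φ w 1 = 0 ∧ ∫ w, u w * fderiv ℝ φ w Complex.I = 0) :
    ∃ c, ∀ᵐ w ∂volume.restrict (Metric.ball z (r / 2)), u w = c := by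
  -- Mollifiers of radius at most `r / 4`: centred at a point of the half disc they remain
  -- admissible test functions in the full disc. The fixed ratio `rOut = 2 * rIn` is what makes the
  -- mollifications converge at almost every point.
  let b : ℕ → ContDiffBump (0 : ℂ) := fun n =>
    { rIn := r / 8 / ((n : ℝ) + 1), rOut := r / 4 / ((n : ℝ) + 1), rIn_pos := by positivity
      rIn_lt_rOut := by
        apply div_lt_div_of_pos_right _ (by positivity)
        linarith }
  have hbout : ∀ n, (b n).rOut ≤ r / 4 := fun n => by
    change r / 4 / ((n : ℝ) + 1) ≤ r / 4
    exact div_le_self (by positivity) (by linarith [Nat.cast_nonneg (α := ℝ) n])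
  have hlim : Tendsto (fun n => (b n).rOut) atTop (𝓝 0) := by
    change Tendsto (fun n : ℕ => r / 4 / ((n : ℝ) + 1)) atTop (𝓝 0)
    exact tendsto_const_div_atTop_nhds_zero_nat (r / 4) |>.comp (tendsto_add_atTop_nat 1) |>.congr
      fun n => by simp
  have hae := ContDiffBump.ae_convolution_tendsto_right_of_locallyIntegrable (μ := volume)
    (K := 2) hlim (Eventually.of_forall fun n => by
      change r / 4 / ((n : ℝ) + 1) ≤ 2 * (r / 8 / ((n : ℝ) + 1))
      rw [← mul_div_assoc]; apply le_of_eq; congr 1; ring) hu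
  set U : ℕ → ℂ → ℝ := fun n => convolution ((b n).normed volume) u
    (ContinuousLinearMap.lsmul ℝ ℝ) volume with hU
  have hconst : ∀ n, ∀ x ∈ Metric.ball z (r / 2), ∀ y ∈ Metric.ball z (r / 2), U n x = U n y := by
    intro n x hx y hy
    set φ := (b n).normed volume with hφ
    have hφc : HasCompactSupport φ := (b n).hasCompactSupport_normed
    have hφs : ContDiff ℝ ((⊤ : ℕ∞) : WithTop ℕ∞) φ := (b n).contDiff_normed
    have hflip : U n = convolution u φ (ContinuousLinearMap.lsmul ℝ ℝ).flip volume := by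
      simp only [hU]
      rw [convolution_flip]
    have hd : ∀ w, HasFDerivAt (U n) (convolution u (fderiv ℝ φ)
        (ContinuousLinearMap.precompR ℂ (ContinuousLinearMap.lsmul ℝ ℝ).flip) volume w) w := by
      intro w
      rw [hflip]
      exact hφc.hasFDerivAt_convolution_right _ hu (hφs.of_le (by exact_mod_cast le_top)) w
    refine Metric.isOpen_ball.is_const_of_fderiv_eq_zero (𝕜 := ℝ)
      (convex_ball z (r / 2)).isPreconnected
      (fun w _ => (hd w).differentiableAt.differentiableWithinAt) ?_ hx hy
    -- The derivative of the mollification at `w` is `u` tested against the gradient of the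
    -- reflected bump `t ↦ φ (w - t)`, which vanishes by hypothesis.
    intro w hw
    rw [(hd w).fderiv]
    set ψ : ℂ → ℝ := fun t => φ (w - t) with hψ
    have hψs : ContDiff ℝ ((⊤ : ℕ∞) : WithTop ℕ∞) ψ := hφs.comp (contDiff_const.sub contDiff_id)
    have hψsupp : Function.support ψ ⊆ Metric.closedBall w (r / 4) := by
      intro t ht
      have : w - t ∈ Function.support φ := ht
      rw [hφ, ContDiffBump.support_normed_eq, Metric.mem_ball, dist_zero_right] at this
      rw [Metric.mem_closedBall, dist_comm, dist_eq_norm]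
      exact this.le.trans (hbout n)
    have hψt : tsupport ψ ⊆ Metric.closedBall w (r / 4) :=
      closure_minimal hψsupp Metric.isClosed_closedBall
    have hψc : HasCompactSupport ψ :=
      (isCompact_closedBall w (r / 4)).of_isClosed_subset (isClosed_tsupport _) hψt
    have hψb : tsupport ψ ⊆ Metric.ball z r := by
      refine hψt.trans fun t ht => ?_
      rw [Metric.mem_closedBall] at ht
      rw [Metric.mem_ball] at hw ⊢
      linarith [dist_triangle t w z]
    have hfd : ∀ t v, fderiv ℝ ψ t v = -fderiv ℝ φ (w - t) v := by
      intro t v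
      have h1 : HasFDerivAt φ (fderiv ℝ φ (w - t)) (w - t) :=
        (hφs.differentiable (by simp)).differentiableAt.hasFDerivAt
      have h2 : HasFDerivAt (fun t : ℂ => w - t) (-ContinuousLinearMap.id ℝ ℂ) t :=
        (hasFDerivAt_id t).const_sub w
      have h3 : HasFDerivAt ψ ((fderiv ℝ φ (w - t)).comp (-ContinuousLinearMap.id ℝ ℂ)) t :=
        h1.comp t h2
      rw [h3.fderiv]
      simp
    have hzero : ∀ v : ℂ, ∫ t, u t * fderiv ℝ ψ t v = 0 →
        convolution u (fderiv ℝ φ)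
          (ContinuousLinearMap.precompR ℂ (ContinuousLinearMap.lsmul ℝ ℝ).flip) volume w v = 0 := by
      intro v hv
      rw [convolution_precompR_apply _ hu (hφc.fderiv ℝ)
        (hφs.continuous_fderiv (by simp)), convolution_def]
      have : ∀ t, (ContinuousLinearMap.lsmul ℝ ℝ).flip (u t) (fderiv ℝ φ (w - t) v) =
          -(u t * fderiv ℝ ψ t v) := by
        intro t
        rw [hfd]
        simp [mul_comm]
      simp_rw [this]
      rw [integral_neg, hv, neg_zero]
    obtain ⟨h1, h2⟩ := h ψ hψs hψc hψb
    ext v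
    have hv : v = v.re • (1 : ℂ) + v.im • Complex.I := by
      apply Complex.ext <;> simp
    rw [hv, map_add, map_smul, map_smul, hzero 1 h1, hzero _ h2]
    simp
  have hae' := ae_restrict_of_ae (s := Metric.ball z (r / 2)) hae
  have : NeBot (ae (volume.restrict (Metric.ball z (r / 2)))) := by
    rw [ae_neBot, Ne, Measure.restrict_eq_zero]
    exact (Metric.measure_ball_pos volume z (by linarith)).ne'
  obtain ⟨x₀, hx₀, hx₀b⟩ :=
    (hae'.and (ae_restrict_mem Metric.isOpen_ball.measurableSet)).exists
  refine ⟨u x₀, ?_⟩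
  filter_upwards [hae', ae_restrict_mem Metric.isOpen_ball.measurableSet] with w hw hwb
  refine tendsto_nhds_unique hw (hx₀.congr fun n => ?_)
  exact hconst n x₀ hx₀b w hwb

/-- A subharmonic function which is almost everywhere equal to a continuous function is equal to
it. -/
theorem IsSubharmonic.eq_of_ae_eq {Ω : TopologicalSpace.Opens ℂ} {V : ℂ → EReal}
    (hV : IsSubharmonic Ω V) {F : ℂ → ℝ} {s : Set ℂ} (hs : IsOpen s) (hsΩ : s ⊆ Ω)
    (hF : ContinuousOn F s)
    (h : ∀ᵐ w ∂volume.restrict s, V w = F w) : ∀ w ∈ s, V w = F w := by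
  intro w hw
  have hFc : ContinuousAt F w := hF.continuousAt (hs.mem_nhds hw)
  -- Upper semicontinuity gives this half: a strict inequality `V w < F w` would persist in a disc,
  -- against equality almost everywhere. The other half is the sub-mean value inequality on small
  -- discs.
  have hbig : (F w : EReal) ≤ V w := by
    by_contra! hlt
    obtain ⟨a, ha1, ha2⟩ := EReal.lt_iff_exists_real_btwn.1 hlt
    have hev1 : ∀ᶠ y in 𝓝 w, V y < a := by
      have := hV.upperSemicontinuousOn w (hsΩ hw) a ha1
      rwa [Ω.isOpen.nhdsWithin_eq (hsΩ hw)] at this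
    have hev2 : ∀ᶠ y in 𝓝 w, a < F y := hFc.eventually (lt_mem_nhds (by exact_mod_cast ha2))
    obtain ⟨r, hr, hsub⟩ := Metric.eventually_nhds_iff_ball.1
      ((hev1.and hev2).and (hs.mem_nhds hw))
    have h' := ae_restrict_of_ae_restrict_of_subset (fun y hy => (hsub y hy).2) h
    have : NeBot (ae (volume.restrict (Metric.ball w r))) := by
      rw [ae_neBot, Ne, Measure.restrict_eq_zero]
      exact (Metric.measure_ball_pos volume w hr).ne'
    obtain ⟨y, hy, hyb⟩ := (h'.and (ae_restrict_mem Metric.isOpen_ball.measurableSet)).exists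
    obtain ⟨⟨h1, h2⟩, -⟩ := hsub y hyb
    rw [hy] at h1
    exact absurd (EReal.coe_lt_coe_iff.1 h1) (not_lt.2 h2.le)
  have hbot : V w ≠ ⊥ := fun hb => by rw [hb] at hbig; simp at hbig
  refine le_antisymm ?_ hbig
  have htop := hV.lt_top w (hsΩ hw)
  rw [← EReal.coe_toReal htop.ne hbot, EReal.coe_le_coe_iff]
  refine le_of_forall_pos_le_add fun ε hε => ?_
  have hev2 : ∀ᶠ y in 𝓝 w, F y < F w + ε := hFc.eventually (gt_mem_nhds (by linarith))
  obtain ⟨r, hr, hsub⟩ := Metric.nhds_basis_closedBall.mem_iff.1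
      (inter_mem hev2 (hs.mem_nhds hw))
  have hsub' : Metric.ball w r ⊆ s := fun y hy => (hsub (Metric.ball_subset_closedBall hy)).2
  obtain ⟨-, hint, hle⟩ := hV.ball_submean hr (fun y hy => hsΩ (hsub hy).2) hbot
  have hvol : 0 < volume.real (Metric.ball w r) :=
    ENNReal.toReal_pos (Metric.measure_ball_pos volume w hr).ne' measure_ball_lt_top.ne
  have : ∫ y in Metric.ball w r, (V y).toReal ≤ ∫ _y in Metric.ball w r, (F w + ε) := by
    refine integral_mono_ae hint (integrableOn_const measure_ball_lt_top.ne) ?_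
    filter_upwards [ae_restrict_of_ae_restrict_of_subset hsub' h,
      ae_restrict_mem Metric.isOpen_ball.measurableSet] with y hy hyb
    rw [hy, EReal.toReal_coe]
    exact (hsub (Metric.ball_subset_closedBall hyb)).1.le
  rw [setIntegral_const, smul_eq_mul] at this
  exact le_of_mul_le_mul_left (hle.trans this) hvol

end SubharmonicConfiguration

/-! ### Local form of `V` on the active sets -/

namespace SubharmonicConfiguration

theorem fderiv_apply_eq_re_dz_mul (f : ℂ → ℝ) (z v : ℂ) :
    fderiv ℝ f z v = 2 * (dz f z * v).re := by
  have hv : v = v.re • (1 : ℂ) + v.im • Complex.I := by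
    apply Complex.ext <;> simp
  conv_lhs => rw [hv, map_add, map_smul, map_smul]
  simp [dz]
  ring

/-- The integral of `F • ∂φ/∂z` in terms of the partial derivatives of `φ`. -/
theorem integral_mul_dz {F φ : ℂ → ℝ} (h1 : Integrable fun w => F w * fderiv ℝ φ w 1)
    (h2 : Integrable fun w => F w * fderiv ℝ φ w Complex.I) :
    ∫ w, (F w : ℂ) * dz φ w =
      ((∫ w, F w * fderiv ℝ φ w 1 : ℝ) - Complex.I * (∫ w, F w * fderiv ℝ φ w Complex.I : ℝ)) / 2 := by
  rw [← integral_complex_ofReal, ← integral_complex_ofReal, ← integral_const_mul, ← integral_sub,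
    ← integral_div]
  · congr 1
    ext w
    simp only [dz]
    push_cast
    ring
  · exact h1.ofReal
  · exact h2.ofReal.const_mul _

theorem integral_dz_mul {F φ : ℂ → ℝ} (h1 : Integrable fun w => fderiv ℝ F w 1 * φ w)
    (h2 : Integrable fun w => fderiv ℝ F w Complex.I * φ w) :
    ∫ w, dz F w * (φ w : ℂ) =
      ((∫ w, fderiv ℝ F w 1 * φ w : ℝ) - Complex.I * (∫ w, fderiv ℝ F w Complex.I * φ w : ℝ)) / 2 := by
  rw [← integral_complex_ofReal, ← integral_complex_ofReal, ← integral_const_mul, ← integral_sub,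
    ← integral_div]
  · congr 1
    ext w
    simp only [dz]
    push_cast
    ring
  · exact h1.ofReal
  · exact h2.ofReal.const_mul _

theorem _root_.Continuous.integrable_mul_of_support_subset {F φ : ℂ → ℝ} {s : Set ℂ} (hφ : Continuous φ)
    (hφc : HasCompactSupport φ) (hs : Function.support φ ⊆ s) (hF : IntegrableOn F s)
    (hsm : MeasurableSet s) : Integrable fun w => F w * φ w := by
  obtain ⟨C, hC⟩ := hφc.exists_bound_of_continuous hφ
  have : (fun w => F w * φ w) = fun w => s.indicator F w * φ w := by
    ext w
    by_cases h : w ∈ s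
    · rw [indicator_of_mem h]
    · rw [indicator_of_notMem h, show φ w = 0 from by_contra fun h' => h (hs h')]; simp
  rw [this]
  exact ((integrable_indicator_iff hsm).2 hF).mul_bdd (c := C) hφ.aestronglyMeasurable
    (Eventually.of_forall hC)

variable {R : ℝ} {V : ℂ → EReal}

theorem isPreconnected_disc : IsPreconnected (disc R : Set ℂ) :=
  (convex_ball (0 : ℂ) R).isPreconnected

/-- In an open set where `∂V/∂z = ∂H/∂z` with `H` harmonic, the function `V - H` is locally
constant. -/
theorem DzEqOn.exists_eq_add_const (hV : IsSubharmonic (disc R) V) {H : ℂ → ℝ} {g : ℂ → ℂ}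
    (hH : InnerProductSpace.HarmonicOnNhd H (Metric.ball 0 R))
    (hHg : ∀ z ∈ Metric.ball (0 : ℂ) R, dz H z = g z) {s : Set ℂ} (hs : IsOpen s)
    (hsub : s ⊆ (disc R : Set ℂ)) (h : DzEqOn (disc R) V g s) {z : ℂ} (hz : z ∈ s) :
    ∃ r > 0, ∃ c : ℝ, Metric.ball z r ⊆ s ∧ ∀ w ∈ Metric.ball z r, V w = (H w + c : ℝ) := by
  obtain ⟨r₁, hr₁, hfin, hint⟩ := hV.exists_ball_integrableOn isPreconnected_disc (hsub hz)
  obtain ⟨r₂, hr₂, hr₂s⟩ := Metric.nhds_basis_closedBall.mem_iff.1 (hs.mem_nhds hz)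
  set r := min r₁ r₂ with hr
  have hr0 : 0 < r := lt_min hr₁ hr₂
  have hrs : Metric.closedBall z r ⊆ s :=
    (Metric.closedBall_subset_closedBall (min_le_right _ _)).trans hr₂s
  have hrR : Metric.closedBall z r ⊆ Metric.ball 0 R := hrs.trans hsub
  have hbs : Metric.ball z r ⊆ s := Metric.ball_subset_closedBall.trans hrs
  have hHd : ∀ w ∈ Metric.ball (0 : ℂ) R, ContDiffAt ℝ 2 H w := fun w hw => (hH w hw).1
  have hfint : IntegrableOn (fun w => (V w).toReal) (Metric.ball z r) :=
    hint.mono_set (Metric.ball_subset_ball (min_le_left _ _))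
  have hHint : IntegrableOn H (Metric.ball z r) := by
    refine IntegrableOn.mono_set (ContinuousOn.integrableOn_compact (isCompact_closedBall z r) ?_)
      Metric.ball_subset_closedBall
    exact fun w hw => (hHd w (hrR hw)).continuousAt.continuousWithinAt
  have hmeas : MeasurableSet (Metric.ball z r) := Metric.isOpen_ball.measurableSet
  -- The cut-off makes the difference integrable on the whole plane; it is invisible to test
  -- functions supported in the disc.
  set u : ℂ → ℝ := (Metric.ball z r).indicator fun w => (V w).toReal - H w with hu
  have hui : Integrable u := (integrable_indicator_iff hmeas).2 (hfint.sub hHint)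
  obtain ⟨c, hc⟩ := ae_eq_const_of_integral_fderiv_eq_zero hui.locallyIntegrable hr0 (by
    intro φ hφs hφc hφt
    have hd : ContDiff ℝ 1 φ := hφs.of_le (by exact_mod_cast le_top)
    have hdv : ∀ v, Continuous fun w => fderiv ℝ φ w v := fun v =>
      (hd.continuous_fderiv (by simp)).clm_apply continuous_const
    have hdc : ∀ v, HasCompactSupport fun w => fderiv ℝ φ w v := fun v => hφc.fderiv_apply ℝ v
    have hds : ∀ v, Function.support (fun w => fderiv ℝ φ w v) ⊆ Metric.ball z r := fun v =>
      (subset_tsupport _).trans ((tsupport_fderiv_apply_subset ℝ v).trans hφt)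
    have i1 : ∀ v, Integrable fun w => (V w).toReal * fderiv ℝ φ w v := fun v =>
      (hdv v).integrable_mul_of_support_subset (hdc v) (hds v) hfint hmeas
    have i2 : ∀ v, Integrable fun w => H w * fderiv ℝ φ w v := fun v =>
      (hdv v).integrable_mul_of_support_subset (hdc v) (hds v) hHint hmeas
    have i3 : ∀ v, Integrable fun w => fderiv ℝ H w v * φ w := by
      intro v
      refine hd.continuous.integrable_mul_of_support_subset hφc ((subset_tsupport _).trans hφt) ?_
        hmeas
      refine IntegrableOn.mono_set (ContinuousOn.integrableOn_compact (isCompact_closedBall z r) ?_)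
        Metric.ball_subset_closedBall
      intro w hw
      exact (((hHd w (hrR hw)).fderiv_right (m := 1) (by norm_num)).continuousAt.clm_apply
        continuousAt_const).continuousWithinAt
    have i4 : Integrable fun w => H w * φ w :=
      hd.continuous.integrable_mul_of_support_subset hφc ((subset_tsupport _).trans hφt) hHint hmeas
    have parts : ∀ v, ∫ w, H w * fderiv ℝ φ w v = -∫ w, fderiv ℝ H w v * φ w := fun v =>
      integral_mul_fderiv_eq_neg_fderiv_mul_of_integrable (i3 v) (i2 v) i4
        (fun w hw => (hHd w (hrR (Metric.ball_subset_closedBall (hφt hw)))).differentiableAt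
          (by norm_num))
        (fun w _ => hd.differentiable (by norm_num) w)
    have hdist := h ⟨φ, hφs, hφc, hφt.trans (hbs.trans hsub)⟩ (hφt.trans hbs)
    change (-∫ w, ((V w).toReal : ℂ) * dz φ w) - ∫ w, g w * (φ w : ℂ) = 0 at hdist
    have hg : ∫ w, g w * (φ w : ℂ) = ∫ w, dz H w * (φ w : ℂ) := by
      congr 1
      ext w
      by_cases hw : w ∈ tsupport φ
      · rw [hHg w (hrR (Metric.ball_subset_closedBall (hφt hw)))]
      · rw [image_eq_zero_of_notMem_tsupport hw]; simp
    rw [hg, integral_mul_dz (i1 1) (i1 _), integral_dz_mul (i3 1) (i3 _)] at hdist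
    have hre := congrArg Complex.re hdist
    have him := congrArg Complex.im hdist
    simp at hre him
    -- Integration by parts moves the derivative from the test function to the smooth `H`. The real
    -- and imaginary parts of the hypothesis then say that both partial derivatives of `V - H`
    -- vanish.
    have huφ : ∀ v, ∫ w, u w * fderiv ℝ φ w v =
        (∫ w, (V w).toReal * fderiv ℝ φ w v) + ∫ w, fderiv ℝ H w v * φ w := by
      intro v
      rw [← sub_neg_eq_add, ← parts v, ← integral_sub (i1 v) (i2 v)]
      congr 1
      ext w
      by_cases hw : w ∈ Metric.ball z r
      · rw [hu, indicator_of_mem hw]; ring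
      · have : fderiv ℝ φ w v = 0 := by_contra fun h' => hw (hds v h')
        rw [this]; simp
    rw [huφ, huφ]
    constructor <;> linarith)
  have hrhalf : Metric.ball z (r / 2) ⊆ Metric.ball z r := Metric.ball_subset_ball (by linarith)
  refine ⟨r / 2, by linarith, c, hrhalf.trans hbs, ?_⟩
  refine hV.eq_of_ae_eq (F := fun w => H w + c) Metric.isOpen_ball (hrhalf.trans (hbs.trans hsub))
    ?_ ?_
  · intro w hw
    have := (hHd w (hrR (Metric.ball_subset_closedBall (hrhalf hw)))).continuousAt
    exact (this.add continuousAt_const).continuousWithinAt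
  · have hfin' := ae_restrict_of_ae_restrict_of_subset
      (hrhalf.trans (Metric.ball_subset_ball (min_le_left _ _))) hfin
    filter_upwards [hc, hfin', ae_restrict_mem Metric.isOpen_ball.measurableSet] with w h1 h2 h3
    rw [hu, indicator_of_mem (hrhalf h3)] at h1
    rw [← EReal.coe_toReal (hV.lt_top w (hsub (hbs (hrhalf h3)))).ne h2]
    congr 1
    linarith

theorem isOpen_diff_suppLaplacian : IsOpen ((disc R : Set ℂ) \ suppLaplacian (disc R) V) := by
  have : (disc R : Set ℂ) \ suppLaplacian (disc R) V =
      (disc R : Set ℂ) ∩ (Distribution.dsupport (distLaplacian (disc R) V))ᶜ := by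
    ext w; simp [suppLaplacian]
  rw [this]
  exact (disc R).isOpen.inter Distribution.isClosed_dsupport.isOpen_compl

/-- In a neighbourhood of every point of the set where `∂V/∂z = g` is the derivative of a harmonic
function `H`, the function `V - H` is constant. -/
theorem exists_ball_of_mem_activeSet (hV : IsSubharmonic (disc R) V) {H : ℂ → ℝ} {g : ℂ → ℂ}
    (hH : InnerProductSpace.HarmonicOnNhd H (Metric.ball 0 R))
    (hHg : ∀ z ∈ Metric.ball (0 : ℂ) R, dz H z = g z) {z : ℂ}
    (hz : z ∈ activeSet (disc R) V g) :
    ∃ r > 0, ∃ c : ℝ, ∀ w ∈ Metric.ball z r, V w = (H w + c : ℝ) := by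
  obtain ⟨r, hr, c, -, h⟩ := DzEqOn.exists_eq_add_const hV hH hHg
    isOpen_diff_suppLaplacian.connectedComponentIn
    ((connectedComponentIn_subset _ _).trans sdiff_subset) hz.2 (mem_connectedComponentIn hz.1)
  exact ⟨r, hr, c, h⟩

end SubharmonicConfiguration

/-! ### Discrete energy estimate -/

namespace SubharmonicConfiguration

/-- After expansion this is `exp (a - b) ≥ 1 + (a - b)`. With `a = V w`, `b = V z` the term linear
in `a - b` has nonnegative mean over discs about `z`, which leaves the squared oscillation of `exp
V` controlled by the growth of the mean of its square. -/
theorem sq_exp_sub_exp_le (a b : ℝ) :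
    (Real.exp a - Real.exp b) ^ 2 + Real.exp b ^ 2 + 2 * Real.exp b ^ 2 * (a - b) ≤
      Real.exp a ^ 2 := by
  have h1 : Real.exp a = Real.exp b * Real.exp (a - b) := by rw [← Real.exp_add]; congr 1; ring
  have h2 := Real.add_one_le_exp (a - b)
  have h3 : 0 < Real.exp b ^ 2 := by positivity
  rw [h1]
  nlinarith

/-- The truncated quadratic cut-off function `((a - |z|²)⁺)²`. -/
noncomputable def quadraticCutoff (a : ℝ) (z : ℂ) : ℝ := (max (a - ‖z‖ ^ 2) 0) ^ 2

theorem continuous_quadraticCutoff (a : ℝ) : Continuous (quadraticCutoff a) := by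
  unfold quadraticCutoff
  fun_prop

theorem sq_posPart_le (s t : ℝ) :
    (max t 0) ^ 2 ≤ (max s 0) ^ 2 + 2 * max s 0 * (t - s) + (t - s) ^ 2 := by
  rcases le_total s 0 with hs | hs <;> rcases le_total t 0 with ht | ht <;>
    simp only [max_eq_left, max_eq_right, hs, ht] <;> nlinarith

/-- A second-difference bound of order `‖v‖ ^ 2` for a cut-off that is not twice differentiable. In
`sq_posPart_le` applied to `v` and `-v`, the first-order terms in `⟪z, v⟫` cancel and the remaining
multiple of the positive part is nonpositive. -/
theorem quadraticCutoff_add_add_sub_le (a : ℝ) (z v : ℂ) :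
    quadraticCutoff a (z - v) + quadraticCutoff a (z + v) ≤
      2 * quadraticCutoff a z + 2 * (2 * ‖z‖ + ‖v‖) ^ 2 * ‖v‖ ^ 2 := by
  unfold quadraticCutoff
  have h1 := sq_posPart_le (a - ‖z‖ ^ 2) (a - ‖z - v‖ ^ 2)
  have h2 := sq_posPart_le (a - ‖z‖ ^ 2) (a - ‖z + v‖ ^ 2)
  have e1 : ‖z - v‖ ^ 2 = ‖z‖ ^ 2 - 2 * inner ℝ z v + ‖v‖ ^ 2 := norm_sub_sq_real z v
  have e2 : ‖z + v‖ ^ 2 = ‖z‖ ^ 2 + 2 * inner ℝ z v + ‖v‖ ^ 2 := norm_add_sq_real z v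
  set p := inner ℝ z v with hp
  have hip : |p| ≤ ‖z‖ * ‖v‖ := abs_real_inner_le_norm z v
  set m := max (a - ‖z‖ ^ 2) 0
  have hm : 0 ≤ m := le_max_right _ _
  have d1 : a - ‖z - v‖ ^ 2 - (a - ‖z‖ ^ 2) = 2 * p - ‖v‖ ^ 2 := by rw [e1]; ring
  have d2 : a - ‖z + v‖ ^ 2 - (a - ‖z‖ ^ 2) = -2 * p - ‖v‖ ^ 2 := by rw [e2]; ring
  rw [d1] at h1
  rw [d2] at h2
  have hp2 : p ^ 2 ≤ (‖z‖ * ‖v‖) ^ 2 := sq_le_sq' (by linarith [abs_le.1 hip]) (abs_le.1 hip).2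
  have hv : 0 ≤ m * ‖v‖ ^ 2 := by positivity
  have hzv : 0 ≤ ‖z‖ * ‖v‖ * ‖v‖ ^ 2 := by positivity
  nlinarith

theorem lintegral_ball_neg (F : ℂ → ENNReal) (r : ℝ) :
    ∫⁻ v in Metric.ball 0 r, F (-v) = ∫⁻ v in Metric.ball 0 r, F v := by
  rw [← lintegral_indicator Metric.isOpen_ball.measurableSet,
    ← lintegral_indicator Metric.isOpen_ball.measurableSet,
    ← lintegral_sub_left_eq_self ((Metric.ball 0 r).indicator F) 0]
  congr 1
  ext v
  by_cases hv : v ∈ Metric.ball (0 : ℂ) r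
  · rw [indicator_of_mem hv, indicator_of_mem (by simpa using hv)]; simp
  · rw [indicator_of_notMem hv, indicator_of_notMem (by simpa using hv)]

/-- The disc is invariant under `v ↦ -v`, so the first difference may be replaced by half of the
symmetric second difference. -/
theorem lintegral_quadraticCutoff_sub_le (a : ℝ) {z : ℂ} {r S : ℝ} (hz : 2 * ‖z‖ + r ≤ S) :
    ∫⁻ v in Metric.ball 0 r, ENNReal.ofReal (quadraticCutoff a (z - v)) ≤
      volume (Metric.ball (0 : ℂ) r) *
        (ENNReal.ofReal (quadraticCutoff a z) + ENNReal.ofReal (S ^ 2 * r ^ 2)) := by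
  have hm : ∀ z, Measurable fun v => ENNReal.ofReal (quadraticCutoff a (z + v)) := fun z =>
    ((continuous_quadraticCutoff a).comp (continuous_const.add continuous_id)).measurable.ennreal_ofReal
  have h0 : ∀ z, 0 ≤ quadraticCutoff a z := fun z => sq_nonneg _
  have h1 := lintegral_ball_neg (fun v => ENNReal.ofReal (quadraticCutoff a (z + v))) r
  simp only [← sub_eq_add_neg] at h1
  have h2 : 2 * ∫⁻ v in Metric.ball 0 r, ENNReal.ofReal (quadraticCutoff a (z - v)) ≤
      2 * (volume (Metric.ball (0 : ℂ) r) *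
        (ENNReal.ofReal (quadraticCutoff a z) + ENNReal.ofReal (S ^ 2 * r ^ 2))) := by
    conv_lhs => rw [two_mul]
    conv_lhs => enter [2]; rw [h1]
    rw [← lintegral_add_right _ (hm z), mul_left_comm, mul_comm, ← setLIntegral_const]
    refine setLIntegral_mono' Metric.isOpen_ball.measurableSet fun v hv => ?_
    rw [mem_ball_zero_iff] at hv
    rw [← ENNReal.ofReal_add (h0 _) (h0 _), ← ENNReal.ofReal_add (h0 _) (by positivity),
      show (2 : ENNReal) = ENNReal.ofReal 2 by simp, ← ENNReal.ofReal_mul (by norm_num)]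
    refine ENNReal.ofReal_le_ofReal ?_
    have h3 := quadraticCutoff_add_add_sub_le a z v
    have h4 : (2 * ‖z‖ + ‖v‖) ^ 2 * ‖v‖ ^ 2 ≤ S ^ 2 * r ^ 2 := by
      gcongr
      linarith
    nlinarith
  exact (ENNReal.mul_le_mul_iff_right (by norm_num) (by norm_num)).1 h2

/-- A discrete energy estimate for functions whose square dominates, in mean over discs, the square
at the centre plus the squared oscillation. -/
theorem exists_lintegral_sq_sub_le {E : ℂ → ℝ} (hEm : Measurable E) {B ρ : ℝ} (hρ : 0 < ρ)
    (hB : ∀ z, |E z| ≤ B) (hsupp : ∀ z, z ∉ Metric.ball (0 : ℂ) (5 * ρ) → E z = 0)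
    (h : ∀ r, 0 < r → r ≤ ρ → ∀ᵐ z, z ∈ Metric.ball (0 : ℂ) (3 * ρ) →
      (∫⁻ v in Metric.ball 0 r, ENNReal.ofReal ((E (z + v) - E z) ^ 2)) +
        volume (Metric.ball (0 : ℂ) r) * ENNReal.ofReal (E z ^ 2) ≤
      ∫⁻ v in Metric.ball 0 r, ENNReal.ofReal (E (z + v) ^ 2)) :
    ∃ C : ENNReal, C ≠ ⊤ ∧ ∀ r, 0 < r → r ≤ ρ →
      ∫⁻ z in Metric.ball (0 : ℂ) (2 * ρ), ∫⁻ v in Metric.ball 0 r,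
        ENNReal.ofReal ((E (z + v) - E z) ^ 2) ≤
      C * ENNReal.ofReal (r ^ 2) * volume (Metric.ball (0 : ℂ) r) := by
  -- This cut-off lives in `|z| < 3ρ`, where the hypothesis holds, and is at least `(5ρ²)²` for `|z|
  -- < 2ρ` because `9 - 4 = 5`.
  set χ : ℂ → ENNReal := fun z => ENNReal.ofReal (quadraticCutoff (9 * ρ ^ 2) z) with hχ
  have hχm : Measurable χ := (continuous_quadraticCutoff _).measurable.ennreal_ofReal
  set e : ℂ → ENNReal := fun z => ENNReal.ofReal (E z ^ 2) with he
  have hem : Measurable e := (hEm.pow_const 2).ennreal_ofReal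
  have heB : ∀ z, e z ≤ (Metric.ball (0 : ℂ) (5 * ρ)).indicator
      (fun _ => ENNReal.ofReal (B ^ 2)) z := by
    intro z
    by_cases hz : z ∈ Metric.ball (0 : ℂ) (5 * ρ)
    · rw [indicator_of_mem hz]
      refine ENNReal.ofReal_le_ofReal ?_
      exact sq_le_sq' (by linarith [neg_le_of_abs_le (hB z)]) (le_of_abs_le (hB z))
    · rw [indicator_of_notMem hz]
      simp [he, hsupp z hz]
  set Q : ENNReal := ∫⁻ z, e z with hQ
  have hQt : Q ≠ ⊤ := by
    refine ne_top_of_le_ne_top ?_ (lintegral_mono heB)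
    rw [lintegral_indicator Metric.isOpen_ball.measurableSet, setLIntegral_const]
    exact ENNReal.mul_ne_top ENNReal.ofReal_ne_top measure_ball_lt_top.ne
  have hχB : ∀ z, χ z ≤ ENNReal.ofReal ((9 * ρ ^ 2) ^ 2) := by
    intro z
    refine ENNReal.ofReal_le_ofReal ?_
    unfold quadraticCutoff
    have : max (9 * ρ ^ 2 - ‖z‖ ^ 2) 0 ≤ 9 * ρ ^ 2 :=
      max_le (by linarith [sq_nonneg ‖z‖]) (by positivity)
    gcongr
  set S : ENNReal := ∫⁻ z, χ z * e z with hS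
  have hSt : S ≠ ⊤ := by
    refine ne_top_of_le_ne_top ?_
      (lintegral_mono fun z => mul_le_mul_left (hχB z) (e z))
    rw [lintegral_const_mul' _ _ ENNReal.ofReal_ne_top]
    exact ENNReal.mul_ne_top ENNReal.ofReal_ne_top hQt
  -- The number `11ρ` bounds `2‖z‖ + r` for `‖z‖ < 5ρ` and `r ≤ ρ`; the denominator is the lower
  -- bound of the cut-off on `|z| < 2ρ`.
  refine ⟨ENNReal.ofReal ((11 * ρ) ^ 2) * Q / ENNReal.ofReal ((5 * ρ ^ 2) ^ 2), ?_, ?_⟩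
  · refine ENNReal.div_ne_top (ENNReal.mul_ne_top ENNReal.ofReal_ne_top hQt) ?_
    simp only [ne_eq, ENNReal.ofReal_eq_zero, not_le]
    positivity
  intro r hr hrρ
  set b := volume (Metric.ball (0 : ℂ) r) with hb
  have hbt : b ≠ ⊤ := measure_ball_lt_top.ne
  have hXm : Measurable fun p : ℂ × ℂ => ENNReal.ofReal ((E (p.1 + p.2) - E p.1) ^ 2) := by
    fun_prop
  have hIm : Measurable fun z => ∫⁻ v in Metric.ball (0 : ℂ) r,
      ENNReal.ofReal ((E (z + v) - E z) ^ 2) := hXm.lintegral_prod_right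
  have hχI : Measurable fun z => χ z * ∫⁻ v in Metric.ball (0 : ℂ) r,
      ENNReal.ofReal ((E (z + v) - E z) ^ 2) := hχm.mul hIm
  set A := ∫⁻ z, χ z * ∫⁻ v in Metric.ball (0 : ℂ) r, ENNReal.ofReal ((E (z + v) - E z) ^ 2)
    with hA
  have hχ0 : ∀ z, z ∉ Metric.ball (0 : ℂ) (3 * ρ) → χ z = 0 := by
    intro z hz
    rw [mem_ball_zero_iff, not_lt] at hz
    simp only [hχ, quadraticCutoff]
    rw [max_eq_right (by nlinarith [norm_nonneg z])]
    simp
  have step1 : A + b * S ≤ ∫⁻ z, χ z * ∫⁻ v in Metric.ball (0 : ℂ) r, e (z + v) := by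
    rw [hA, hS, ← lintegral_const_mul' _ _ hbt, ← lintegral_add_left hχI]
    refine lintegral_mono_ae ?_
    filter_upwards [h r hr hrρ] with z hz
    by_cases hzb : z ∈ Metric.ball (0 : ℂ) (3 * ρ)
    · rw [mul_left_comm, ← mul_add]
      exact mul_le_mul_right (hz hzb) _
    · simp [hχ0 z hzb]
  -- Summation by parts: translation moves the shift from `E²` to the cut-off, whose disc means
  -- exceed its values only by `O(r²)`.
  have step2 : ∫⁻ z, χ z * ∫⁻ v in Metric.ball (0 : ℂ) r, e (z + v) =
      ∫⁻ z, e z * ∫⁻ v in Metric.ball (0 : ℂ) r, χ (z - v) := by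
    calc ∫⁻ z, χ z * ∫⁻ v in Metric.ball (0 : ℂ) r, e (z + v)
        = ∫⁻ z, ∫⁻ v in Metric.ball (0 : ℂ) r, χ z * e (z + v) := by
          refine lintegral_congr fun z => ?_
          rw [lintegral_const_mul _ (by fun_prop)]
      _ = ∫⁻ v in Metric.ball (0 : ℂ) r, ∫⁻ z, χ z * e (z + v) :=
          lintegral_lintegral_swap (by fun_prop)
      _ = ∫⁻ v in Metric.ball (0 : ℂ) r, ∫⁻ z, χ (z - v) * e z := by
          refine lintegral_congr fun v => ?_
          rw [← lintegral_add_right_eq_self (fun z => χ (z - v) * e z) v]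
          simp
      _ = ∫⁻ z, ∫⁻ v in Metric.ball (0 : ℂ) r, χ (z - v) * e z :=
          lintegral_lintegral_swap (by fun_prop)
      _ = _ := by
          refine lintegral_congr fun z => ?_
          rw [lintegral_mul_const _ (by fun_prop), mul_comm]
  have step3 : ∫⁻ z, e z * ∫⁻ v in Metric.ball (0 : ℂ) r, χ (z - v) ≤
      ENNReal.ofReal ((11 * ρ) ^ 2 * r ^ 2) * b * Q + b * S := by
    calc ∫⁻ z, e z * ∫⁻ v in Metric.ball (0 : ℂ) r, χ (z - v)
        ≤ ∫⁻ z, (ENNReal.ofReal ((11 * ρ) ^ 2 * r ^ 2) * b * e z + b * (χ z * e z)) := by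
          refine lintegral_mono fun z => ?_
          by_cases hz : z ∈ Metric.ball (0 : ℂ) (5 * ρ)
          · rw [mem_ball_zero_iff] at hz
            have := mul_le_mul_right (lintegral_quadraticCutoff_sub_le (9 * ρ ^ 2)
              (z := z) (r := r) (S := 11 * ρ) (by linarith)) (e z)
            refine this.trans (le_of_eq ?_)
            simp only [hχ, hb]
            ring
          · simp [he, hsupp z hz]
      _ = _ := by
          rw [lintegral_add_right _ (by fun_prop), lintegral_const_mul _ hem,
            lintegral_const_mul _ (by fun_prop)]
  -- The zeroth-order terms `b * S` on the two sides are finite and cancel, leaving a bound of order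
  -- `r²`.
  have step4 : A ≤ ENNReal.ofReal ((11 * ρ) ^ 2 * r ^ 2) * b * Q :=
    (ENNReal.add_le_add_iff_right (ENNReal.mul_ne_top hbt hSt)).1
      (step1.trans (step2.le.trans step3))
  have step5 : ENNReal.ofReal ((5 * ρ ^ 2) ^ 2) * ∫⁻ z in Metric.ball (0 : ℂ) (2 * ρ),
      ∫⁻ v in Metric.ball 0 r, ENNReal.ofReal ((E (z + v) - E z) ^ 2) ≤ A := by
    rw [← lintegral_const_mul _ hIm]
    refine le_trans ?_ (setLIntegral_le_lintegral (Metric.ball (0 : ℂ) (2 * ρ)) _)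
    refine setLIntegral_mono' Metric.isOpen_ball.measurableSet fun z hz => ?_
    refine mul_le_mul_left ?_ _
    refine ENNReal.ofReal_le_ofReal ?_
    rw [mem_ball_zero_iff] at hz
    unfold quadraticCutoff
    have : 5 * ρ ^ 2 ≤ max (9 * ρ ^ 2 - ‖z‖ ^ 2) 0 :=
      le_max_of_le_left (by nlinarith [norm_nonneg z])
    gcongr
  have hpos : ENNReal.ofReal ((5 * ρ ^ 2) ^ 2) ≠ 0 := by
    simp only [ne_eq, ENNReal.ofReal_eq_zero, not_le]
    positivity
  have step6 := (ENNReal.le_div_iff_mul_le (Or.inl hpos) (Or.inl ENNReal.ofReal_ne_top)).2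
    ((mul_comm _ _).le.trans (step5.trans step4))
  refine step6.trans (le_of_eq ?_)
  rw [ENNReal.ofReal_mul (by positivity)]
  simp only [ENNReal.div_eq_inv_mul]
  ring

end SubharmonicConfiguration

/-! ### Crossing a null set: the almost everywhere growth bound -/

namespace SubharmonicConfiguration

theorem setLIntegral_ball_comp_nat_smul {G : ℂ → ENNReal} (hG : Measurable G) {n : ℕ} (hn : 0 < n)
    (ρ : ℝ) :
    ∫⁻ v in Metric.ball (0 : ℂ) (ρ / n), G ((n : ℝ) • v) =
      ENNReal.ofReal |((n : ℝ) ^ Module.finrank ℝ ℂ)⁻¹| * ∫⁻ h in Metric.ball (0 : ℂ) ρ, G h := by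
  have hn' : (0 : ℝ) < n := by exact_mod_cast hn
  have hGi : Measurable ((Metric.ball (0 : ℂ) ρ).indicator G) :=
    hG.indicator Metric.isOpen_ball.measurableSet
  have h1 := lintegral_map (μ := volume) hGi (measurable_const_smul (n : ℝ) : Measurable fun v : ℂ => (n : ℝ) • v)
  rw [Measure.map_addHaar_smul _ hn'.ne', lintegral_smul_measure,
    lintegral_indicator Metric.isOpen_ball.measurableSet] at h1
  rw [← smul_eq_mul, h1, ← lintegral_indicator Metric.isOpen_ball.measurableSet]
  congr 1
  ext v
  have hiff : v ∈ Metric.ball (0 : ℂ) (ρ / n) ↔ (n : ℝ) • v ∈ Metric.ball (0 : ℂ) ρ := by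
    rw [mem_ball_zero_iff, mem_ball_zero_iff, norm_smul, Real.norm_of_nonneg hn'.le,
      lt_div_iff₀ hn', mul_comm]
  by_cases hv : v ∈ Metric.ball (0 : ℂ) (ρ / n)
  · rw [indicator_of_mem hv, indicator_of_mem (hiff.1 hv)]
  · rw [indicator_of_notMem hv, indicator_of_notMem fun h => hv (hiff.2 h)]

/-- The excess over growth by the factor `c` per step, accumulated over `m` steps. An excess at one
step is later multiplied by at most `c ^ m`, because `1 ≤ c`. -/
theorem ofReal_telescope_le (E : ℂ → ℝ) (c : ℝ) (hc : 1 ≤ c) (z v : ℂ) (m : ℕ) :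
    ENNReal.ofReal (E (z + (m : ℝ) • v) - c ^ m * E z) ≤ ENNReal.ofReal (c ^ m) *
      ∑ j ∈ Finset.range m, ENNReal.ofReal (E (z + (j : ℝ) • v + v) - c * E (z + (j : ℝ) • v)) := by
  induction m with
  | zero => simp
  | succ m ih =>
    have hc0 : 0 ≤ c := by linarith
    have e1 : z + ((m + 1 : ℕ) : ℝ) • v = z + (m : ℝ) • v + v := by
      push_cast; rw [add_smul, one_smul, add_assoc]
    have e2 : E (z + ((m + 1 : ℕ) : ℝ) • v) - c ^ (m + 1) * E z =
        (E (z + (m : ℝ) • v + v) - c * E (z + (m : ℝ) • v)) +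
          c * (E (z + (m : ℝ) • v) - c ^ m * E z) := by rw [e1]; ring
    rw [e2, Finset.sum_range_succ, mul_add, add_comm]
    refine ENNReal.ofReal_add_le.trans (add_le_add ?_ ?_)
    · rw [ENNReal.ofReal_mul hc0, pow_succ', ENNReal.ofReal_mul hc0, mul_assoc]
      exact mul_le_mul_right ih _
    · refine le_mul_of_one_le_left zero_le ?_
      rw [ENNReal.one_le_ofReal]
      exact one_le_pow₀ hc

/-- A displacement is split into `n` steps shorter than `r = ρ / n`. A step starting farther than
`r` from `K` has no excess. For the others the increment `x` satisfies `x ≤ x² / (κ r) + κ r`. The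
energy bound makes the first terms contribute `O(r / κ)` per step and the second terms `κ r` times
the area of the `r`-neighbourhood of `K`. Since `n * r = ρ`, the total is `O(1 / κ)` plus `κ` times
an area tending to zero: first `n → ∞`, then `κ → ∞`. -/
theorem ae_le_exp_mul_of_energy {E : ℂ → ℝ} (hEm : Measurable E) (hE0 : ∀ z, 0 ≤ E z)
    {ρ L : ℝ} (hρ : 0 < ρ) (hL : 0 ≤ L) {C : ENNReal} (hC : C ≠ ⊤)
    (henergy : ∀ r, 0 < r → r ≤ ρ →
      ∫⁻ z in Metric.ball (0 : ℂ) (2 * ρ), ∫⁻ v in Metric.ball 0 r,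
        ENNReal.ofReal ((E (z + v) - E z) ^ 2) ≤
      C * ENNReal.ofReal (r ^ 2) * volume (Metric.ball (0 : ℂ) r))
    {K : Set ℂ} (hK : IsCompact K) (hK0 : volume K = 0)
    (hLip : ∀ z ∈ Metric.ball (0 : ℂ) (2 * ρ), ∀ v ∈ Metric.ball (0 : ℂ) ρ,
      (∀ t ∈ Icc (0 : ℝ) 1, z + t • v ∉ K) → E (z + v) ≤ Real.exp (L * ‖v‖) * E z) :
    ∀ᵐ h ∂volume.restrict (Metric.ball (0 : ℂ) ρ), ∀ᵐ z ∂volume.restrict (Metric.ball (0 : ℂ) ρ),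
      E (z + h) ≤ Real.exp (L * ‖h‖) * E z := by
  have hIm : Measurable fun p : ℂ × ℂ =>
      ENNReal.ofReal (E (p.2 + p.1) - Real.exp (L * ‖p.1‖) * E p.2) := by fun_prop
  set G : ℂ → ENNReal := fun h => ∫⁻ z in Metric.ball (0 : ℂ) ρ,
    ENNReal.ofReal (E (z + h) - Real.exp (L * ‖h‖) * E z) with hG
  have hGm : Measurable G := hIm.lintegral_prod_right
  set I : ENNReal := ∫⁻ h in Metric.ball (0 : ℂ) ρ, G h with hI
  set b := volume (Metric.ball (0 : ℂ) ρ) with hb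
  have hbt : b ≠ ⊤ := measure_ball_lt_top.ne
  have main : ∀ κ : ℝ, 0 < κ → ∀ n : ℕ, 0 < n →
      I ≤ ENNReal.ofReal (Real.exp (L * ρ) * ρ) *
        (C * ENNReal.ofReal κ⁻¹ + ENNReal.ofReal κ * volume (Metric.cthickening (ρ / n) K)) * b := by
    intro κ hκ n hn
    have hn' : (0 : ℝ) < n := by exact_mod_cast hn
    have hn1 : (1 : ℝ) ≤ n := by exact_mod_cast hn
    set r := ρ / n with hr
    have hr0 : 0 < r := by positivity
    have hrρ : r ≤ ρ := div_le_self hρ.le hn1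
    have hnr : n * r = ρ := by rw [hr]; field_simp
    set F : ℂ → ℂ → ENNReal := fun v w => ENNReal.ofReal (E (w + v) - Real.exp (L * ‖v‖) * E w)
      with hF
    have hFm : Measurable (Function.uncurry F) := by
      simp only [hF, Function.uncurry_def]; fun_prop
    have hpt : ∀ v ∈ Metric.ball (0 : ℂ) r, ∀ w ∈ Metric.ball (0 : ℂ) (2 * ρ),
        F v w ≤ ENNReal.ofReal (κ * r)⁻¹ * ENNReal.ofReal ((E (w + v) - E w) ^ 2) +
          (Metric.cthickening r K).indicator (fun _ => ENNReal.ofReal (κ * r)) w := by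
      intro v hv w hw
      have hκr : 0 < κ * r := by positivity
      rw [mem_ball_zero_iff] at hv
      by_cases hwK : w ∈ Metric.cthickening r K
      · rw [indicator_of_mem hwK, ← ENNReal.ofReal_mul (by positivity),
          ← ENNReal.ofReal_add (by positivity) hκr.le]
        refine ENNReal.ofReal_le_ofReal ?_
        have h1 : E w ≤ Real.exp (L * ‖v‖) * E w :=
          le_mul_of_one_le_left (hE0 w) (Real.one_le_exp (by positivity))
        set x := E (w + v) - E w with hx
        have h2 : x ≤ (κ * r)⁻¹ * x ^ 2 + κ * r := by
          have h3 : (κ * r)⁻¹ * x ^ 2 + κ * r - x =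
              (κ * r)⁻¹ * ((x - κ * r / 2) ^ 2 + 3 / 4 * (κ * r) ^ 2) := by
            field_simp; ring
          have : 0 ≤ (κ * r)⁻¹ * ((x - κ * r / 2) ^ 2 + 3 / 4 * (κ * r) ^ 2) := by positivity
          linarith
        linarith
      · have : E (w + v) ≤ Real.exp (L * ‖v‖) * E w := by
          refine hLip w hw v (by rw [mem_ball_zero_iff]; linarith) fun t ht htK => hwK ?_
          refine Metric.mem_cthickening_of_dist_le w (w + t • v) r K htK ?_
          rw [dist_self_add_right, norm_smul, Real.norm_of_nonneg ht.1]
          nlinarith [ht.2, norm_nonneg v]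
        simp only [hF]
        rw [ENNReal.ofReal_of_nonpos (by linarith)]
        exact zero_le
    have hsqm : Measurable fun p : ℂ × ℂ => ENNReal.ofReal ((E (p.2 + p.1) - E p.2) ^ 2) := by
      fun_prop
    have hthm : MeasurableSet (Metric.cthickening r K) := Metric.isClosed_cthickening.measurableSet
    have hFint : ∫⁻ v in Metric.ball (0 : ℂ) r, ∫⁻ w in Metric.ball (0 : ℂ) (2 * ρ), F v w ≤
        ENNReal.ofReal r * (C * ENNReal.ofReal κ⁻¹ +
          ENNReal.ofReal κ * volume (Metric.cthickening r K)) *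
          volume (Metric.ball (0 : ℂ) r) := by
      calc ∫⁻ v in Metric.ball (0 : ℂ) r, ∫⁻ w in Metric.ball (0 : ℂ) (2 * ρ), F v w
          ≤ ∫⁻ v in Metric.ball (0 : ℂ) r, (ENNReal.ofReal (κ * r)⁻¹ *
              (∫⁻ w in Metric.ball (0 : ℂ) (2 * ρ), ENNReal.ofReal ((E (w + v) - E w) ^ 2)) +
              ENNReal.ofReal (κ * r) * volume (Metric.cthickening r K)) := by
            refine setLIntegral_mono' Metric.isOpen_ball.measurableSet fun v hv => ?_
            refine (setLIntegral_mono' Metric.isOpen_ball.measurableSet (hpt v hv)).trans ?_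
            rw [lintegral_add_right _ (measurable_const.indicator hthm),
              lintegral_const_mul _ (by fun_prop)]
            gcongr
            refine (setLIntegral_le_lintegral _ _).trans ?_
            rw [lintegral_indicator hthm, setLIntegral_const]
        _ = ENNReal.ofReal (κ * r)⁻¹ * (∫⁻ w in Metric.ball (0 : ℂ) (2 * ρ),
              ∫⁻ v in Metric.ball (0 : ℂ) r, ENNReal.ofReal ((E (w + v) - E w) ^ 2)) +
              ENNReal.ofReal (κ * r) * volume (Metric.cthickening r K) *
                volume (Metric.ball (0 : ℂ) r) := by
            rw [lintegral_add_right _ measurable_const, setLIntegral_const,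
              lintegral_const_mul _ hsqm.lintegral_prod_right,
              lintegral_lintegral_swap hsqm.aemeasurable]
        _ ≤ ENNReal.ofReal (κ * r)⁻¹ * (C * ENNReal.ofReal (r ^ 2) *
              volume (Metric.ball (0 : ℂ) r)) +
              ENNReal.ofReal (κ * r) * volume (Metric.cthickening r K) *
                volume (Metric.ball (0 : ℂ) r) := by
            gcongr
            exact henergy r hr0 hrρ
        _ = _ := by
            have : ENNReal.ofReal (κ * r)⁻¹ * ENNReal.ofReal (r ^ 2) =
                ENNReal.ofReal r * ENNReal.ofReal κ⁻¹ := by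
              rw [← ENNReal.ofReal_mul (by positivity), ← ENNReal.ofReal_mul (by positivity)]
              congr 1
              field_simp
            rw [show ENNReal.ofReal (κ * r)⁻¹ * (C * ENNReal.ofReal (r ^ 2) *
              volume (Metric.ball (0 : ℂ) r)) = (ENNReal.ofReal (κ * r)⁻¹ * ENNReal.ofReal (r ^ 2)) *
              (C * volume (Metric.ball (0 : ℂ) r)) by ring, this, ENNReal.ofReal_mul hκ.le]
            ring
    have hGle : ∀ v ∈ Metric.ball (0 : ℂ) r, G ((n : ℝ) • v) ≤
        ENNReal.ofReal (Real.exp (L * ρ)) * (n * ∫⁻ w in Metric.ball (0 : ℂ) (2 * ρ), F v w) := by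
      intro v hv
      rw [mem_ball_zero_iff] at hv
      have hexp : Real.exp (L * ‖(n : ℝ) • v‖) = Real.exp (L * ‖v‖) ^ n := by
        rw [← Real.exp_nat_mul, norm_smul, Real.norm_of_nonneg hn'.le]
        congr 1; ring
      have hexp' : Real.exp (L * ‖v‖) ^ n ≤ Real.exp (L * ρ) := by
        rw [← hexp, norm_smul, Real.norm_of_nonneg hn'.le]
        refine Real.exp_le_exp.2 (mul_le_mul_of_nonneg_left ?_ hL)
        rw [← hnr]
        exact mul_le_mul_of_nonneg_left hv.le hn'.le
      have hFv : ∀ j : ℕ, Measurable fun z : ℂ => F v (z + (j : ℝ) • v) := fun j => by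
        simp only [hF]; fun_prop
      simp only [hG, hexp]
      calc ∫⁻ z in Metric.ball (0 : ℂ) ρ,
            ENNReal.ofReal (E (z + (n : ℝ) • v) - Real.exp (L * ‖v‖) ^ n * E z)
          ≤ ∫⁻ z in Metric.ball (0 : ℂ) ρ, ENNReal.ofReal (Real.exp (L * ρ)) *
              ∑ j ∈ Finset.range n, F v (z + (j : ℝ) • v) := by
            refine lintegral_mono fun z => ?_
            refine (ofReal_telescope_le E _ (Real.one_le_exp (by positivity)) z v n).trans ?_
            gcongr
        _ = ENNReal.ofReal (Real.exp (L * ρ)) * ∑ j ∈ Finset.range n,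
              ∫⁻ z in Metric.ball (0 : ℂ) ρ, F v (z + (j : ℝ) • v) := by
            rw [lintegral_const_mul _ (Finset.measurable_fun_sum _ fun j _ => hFv j),
              lintegral_finsetSum _ fun j _ => hFv j]
        _ ≤ ENNReal.ofReal (Real.exp (L * ρ)) * ∑ j ∈ Finset.range n,
              ∫⁻ w in Metric.ball (0 : ℂ) (2 * ρ), F v w := by
            refine mul_le_mul_right (Finset.sum_le_sum fun j hj => ?_) _
            rw [← lintegral_indicator Metric.isOpen_ball.measurableSet,
              ← lintegral_indicator Metric.isOpen_ball.measurableSet,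
              ← lintegral_add_right_eq_self ((Metric.ball (0 : ℂ) (2 * ρ)).indicator _)
                ((j : ℝ) • v)]
            refine lintegral_mono fun z => ?_
            by_cases hz : z ∈ Metric.ball (0 : ℂ) ρ
            · rw [indicator_of_mem hz, indicator_of_mem]
              rw [mem_ball_zero_iff] at hz ⊢
              have hjn : (j : ℝ) ≤ n := by exact_mod_cast (Finset.mem_range.1 hj).le
              have : ‖(j : ℝ) • v‖ ≤ ρ := by
                rw [norm_smul, Real.norm_of_nonneg (Nat.cast_nonneg j), ← hnr]
                exact mul_le_mul hjn hv.le (norm_nonneg _) hn'.le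
              linarith [norm_add_le z ((j : ℝ) • v)]
            · rw [indicator_of_notMem hz]; exact zero_le
        _ = _ := by rw [Finset.sum_const, Finset.card_range, nsmul_eq_mul]
    -- The substitution `h = n • v` turns the integral over single steps into the one over full
    -- displacements. The same Jacobian appears in the areas of the discs and is cancelled.
    have hscale := setLIntegral_ball_comp_nat_smul hGm hn ρ
    have hscale1 := setLIntegral_ball_comp_nat_smul (G := fun _ => 1) measurable_const hn ρ
    simp only [setLIntegral_const, one_mul] at hscale1
    set c := ENNReal.ofReal |((n : ℝ) ^ Module.finrank ℝ ℂ)⁻¹| with hc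
    have hc0 : c ≠ 0 := by
      simp only [hc, ne_eq, ENNReal.ofReal_eq_zero, not_le]
      positivity
    have hct : c ≠ ⊤ := ENNReal.ofReal_ne_top
    refine (ENNReal.mul_le_mul_iff_right hc0 hct).1 ?_
    rw [← hscale]
    refine (setLIntegral_mono' Metric.isOpen_ball.measurableSet hGle).trans ?_
    rw [lintegral_const_mul' _ _ ENNReal.ofReal_ne_top,
      lintegral_const_mul' _ _ (ENNReal.natCast_ne_top n)]
    refine (mul_le_mul_right (mul_le_mul_right hFint _) _).trans (le_of_eq ?_)
    have hρn : ENNReal.ofReal ρ = n * ENNReal.ofReal r := by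
      rw [← hnr, ENNReal.ofReal_mul hn'.le, ENNReal.ofReal_natCast]
    rw [hscale1, ENNReal.ofReal_mul (Real.exp_nonneg _), hρn]
    ring
  have hth : Tendsto (fun n : ℕ => volume (Metric.cthickening (ρ / n) K)) atTop (𝓝 0) := by
    have h1 := tendsto_measure_cthickening_of_isCompact (μ := volume) hK
    rw [hK0] at h1
    exact h1.comp (tendsto_const_div_atTop_nhds_zero_nat ρ)
  set A := ENNReal.ofReal (Real.exp (L * ρ) * ρ) with hA
  have hI1 : ∀ κ : ℝ, 0 < κ → I ≤ A * (C * ENNReal.ofReal κ⁻¹) * b := by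
    intro κ hκ
    have hlim : Tendsto (fun n : ℕ => A * (C * ENNReal.ofReal κ⁻¹ +
        ENNReal.ofReal κ * volume (Metric.cthickening (ρ / n) K)) * b) atTop
        (𝓝 (A * (C * ENNReal.ofReal κ⁻¹ + ENNReal.ofReal κ * 0) * b)) := by
      refine ENNReal.Tendsto.mul_const (ENNReal.Tendsto.const_mul (tendsto_const_nhds.add
        (ENNReal.Tendsto.const_mul hth (Or.inr ENNReal.ofReal_ne_top)))
        (Or.inr ENNReal.ofReal_ne_top)) (Or.inr hbt)
    rw [mul_zero, add_zero] at hlim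
    refine ge_of_tendsto hlim ?_
    filter_upwards [eventually_gt_atTop 0] with n hn
    exact main κ hκ n hn
  have hI0 : I = 0 := by
    have hlim : Tendsto (fun κ : ℝ => A * (C * ENNReal.ofReal κ⁻¹) * b) atTop
        (𝓝 (A * (C * ENNReal.ofReal 0) * b)) := by
      refine ENNReal.Tendsto.mul_const (ENNReal.Tendsto.const_mul (ENNReal.Tendsto.const_mul
        ((ENNReal.continuous_ofReal.tendsto 0).comp tendsto_inv_atTop_zero) (Or.inr hC))
        (Or.inr ENNReal.ofReal_ne_top)) (Or.inr hbt)
    have h0 : I ≤ A * (C * ENNReal.ofReal 0) * b := by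
      refine ge_of_tendsto hlim ?_
      filter_upwards [eventually_gt_atTop 0] with κ hκ
      exact hI1 κ hκ
    simpa using h0
  rw [hI, lintegral_eq_zero_iff hGm] at hI0
  filter_upwards [hI0] with h hh
  simp only [hG, Pi.zero_apply] at hh
  rw [lintegral_eq_zero_iff (by fun_prop)] at hh
  filter_upwards [hh] with z hz
  simp only [Pi.zero_apply, ENNReal.ofReal_eq_zero] at hz
  linarith

end SubharmonicConfiguration

/-! ### Lipschitz continuity of `V` -/

namespace SubharmonicConfiguration

/-- The function `exp V`, extended by zero outside of `s`. -/
noncomputable def expOn (s : Set ℂ) (V : ℂ → EReal) (z : ℂ) : ℝ :=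
  s.indicator (fun z => (EReal.exp (V z)).toReal) z

variable {R : ℝ} {V : ℂ → EReal} {s : Set ℂ}

theorem expOn_nonneg (z : ℂ) : 0 ≤ expOn s V z :=
  indicator_nonneg (fun _ _ => ENNReal.toReal_nonneg) z

theorem expOn_of_eq_coe {z : ℂ} (hz : z ∈ s) {a : ℝ} (ha : V z = a) :
    expOn s V z = Real.exp a := by
  rw [expOn, indicator_of_mem hz, ha, EReal.exp_coe, ENNReal.toReal_ofReal (Real.exp_nonneg _)]

theorem expOn_of_eq_bot {z : ℂ} (hz : V z = ⊥) : expOn s V z = 0 := by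
  by_cases h : z ∈ s
  · rw [expOn, indicator_of_mem h, hz]; simp
  · rw [expOn, indicator_of_notMem h]

theorem expOn_le_exp {z : ℂ} {a : ℝ} (ha : V z ≤ a) : expOn s V z ≤ Real.exp a := by
  by_cases h : z ∈ s
  · rw [expOn, indicator_of_mem h]
    refine ENNReal.toReal_le_of_le_ofReal (Real.exp_nonneg _) ?_
    rw [← EReal.exp_coe]
    exact EReal.exp_monotone ha
  · rw [expOn, indicator_of_notMem h]
    exact Real.exp_nonneg _

theorem IsSubharmonic.measurable_expOn {Ω : TopologicalSpace.Opens ℂ} (hV : IsSubharmonic Ω V)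
    (hs : MeasurableSet s) (hsΩ : s ⊆ Ω) : Measurable (expOn s V) := by
  obtain ⟨V₀, hm, heq⟩ := exists_measurable_eqOn hV.upperSemicontinuousOn
  have : expOn s V = s.indicator fun z => (EReal.exp (V₀ z)).toReal := by
    ext z
    by_cases h : z ∈ s
    · rw [expOn, indicator_of_mem h, indicator_of_mem h, heq (hsΩ h)]
    · rw [expOn, indicator_of_notMem h, indicator_of_notMem h]
  rw [this]
  exact ((EReal.exp_monotone.measurable.comp hm).ennreal_toReal).indicator hs

theorem setLIntegral_ball_translate (F : ℂ → ENNReal) (z : ℂ) (r : ℝ) :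
    ∫⁻ v in Metric.ball 0 r, F (z + v) = ∫⁻ w in Metric.ball z r, F w := by
  rw [← lintegral_indicator Metric.isOpen_ball.measurableSet,
    ← lintegral_indicator Metric.isOpen_ball.measurableSet,
    ← lintegral_add_left_eq_self ((Metric.ball z r).indicator F) z]
  congr 1
  ext v
  by_cases hv : v ∈ Metric.ball (0 : ℂ) r
  · rw [indicator_of_mem hv, indicator_of_mem (by simpa using hv)]
  · rw [indicator_of_notMem hv, indicator_of_notMem (by simpa using hv)]

/-- `sq_exp_sub_exp_le` integrated over the disc, the linear term being dropped by
`IsSubharmonic.ball_submean`. The exponential is used since `V` may be unbounded below, whereas `exp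
V` is bounded and vanishes where `V = ⊥`. -/
theorem IsSubharmonic.lintegral_sq_expOn_sub_le {Ω : TopologicalSpace.Opens ℂ}
    (hV : IsSubharmonic Ω V) (hs : IsOpen s) (hsΩ : s ⊆ Ω) {B : ℝ}
    (hB : ∀ z, |expOn s V z| ≤ B) {z : ℂ} {r : ℝ} (hr : 0 < r)
    (hzr : Metric.closedBall z r ⊆ s) (hz : V z ≠ ⊥) :
    (∫⁻ v in Metric.ball 0 r, ENNReal.ofReal ((expOn s V (z + v) - expOn s V z) ^ 2)) +
        volume (Metric.ball (0 : ℂ) r) * ENNReal.ofReal (expOn s V z ^ 2) ≤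
      ∫⁻ v in Metric.ball 0 r, ENNReal.ofReal (expOn s V (z + v) ^ 2) := by
  obtain ⟨hae, hint, hle⟩ := hV.ball_submean hr (hzr.trans hsΩ) hz
  set E := expOn s V with hE
  have hEm : Measurable E := hV.measurable_expOn hs.measurableSet hsΩ
  have hvol : volume (Metric.ball (0 : ℂ) r) = volume (Metric.ball z r) := by
    rw [Complex.volume_ball, Complex.volume_ball]
  rw [setLIntegral_ball_translate (fun w => ENNReal.ofReal ((E w - E z) ^ 2)),
    setLIntegral_ball_translate (fun w => ENNReal.ofReal (E w ^ 2)), hvol]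
  have hEi : Integrable E (volume.restrict (Metric.ball z r)) :=
    Measure.integrableOn_of_bounded measure_ball_lt_top.ne hEm.aestronglyMeasurable
      (Eventually.of_forall hB)
  have hEi2 : Integrable (fun w => E w ^ 2) (volume.restrict (Metric.ball z r)) := by
    refine Measure.integrableOn_of_bounded (M := B ^ 2) measure_ball_lt_top.ne
      (hEm.pow_const 2).aestronglyMeasurable (Eventually.of_forall fun w => ?_)
    rw [Real.norm_of_nonneg (sq_nonneg _)]
    exact sq_le_sq' (by linarith [neg_le_of_abs_le (hB w)]) (le_of_abs_le (hB w))
  have hci : ∀ c : ℝ, Integrable (fun _ => c) (volume.restrict (Metric.ball z r)) := fun c =>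
    integrableOn_const measure_ball_lt_top.ne
  have hdi : Integrable (fun w => (E w - E z) ^ 2) (volume.restrict (Metric.ball z r)) := by
    have : (fun w => (E w - E z) ^ 2) = fun w => E w ^ 2 - 2 * E z * E w + E z ^ 2 := by
      ext w; ring
    rw [this]
    exact (hEi2.sub (hEi.const_mul _)).add (hci _)
  rw [← ofReal_integral_eq_lintegral_ofReal hdi (Eventually.of_forall fun _ => sq_nonneg _),
    ← ofReal_integral_eq_lintegral_ofReal hEi2 (Eventually.of_forall fun _ => sq_nonneg _),
    ← ofReal_measureReal measure_ball_lt_top.ne, ← ENNReal.ofReal_mul measureReal_nonneg,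
    ← ENNReal.ofReal_add (integral_nonneg fun _ => sq_nonneg _) (by positivity)]
  refine ENNReal.ofReal_le_ofReal ?_
  have hzs : z ∈ s := hzr (Metric.mem_closedBall_self hr.le)
  have hEz : E z = Real.exp (V z).toReal :=
    expOn_of_eq_coe hzs (EReal.coe_toReal (hV.lt_top z (hsΩ hzs)).ne hz).symm
  have key : ∫ w in Metric.ball z r, ((E w - E z) ^ 2 + E z ^ 2 +
      2 * E z ^ 2 * ((V w).toReal - (V z).toReal)) ≤ ∫ w in Metric.ball z r, E w ^ 2 := by
    refine integral_mono_ae ((hdi.add (hci _)).add ((hint.sub (hci _)).const_mul _)) hEi2 ?_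
    filter_upwards [hae, ae_restrict_mem Metric.isOpen_ball.measurableSet] with w hw hwb
    have hws : w ∈ s := hzr (Metric.ball_subset_closedBall hwb)
    have hEw : E w = Real.exp (V w).toReal :=
      expOn_of_eq_coe hws (EReal.coe_toReal (hV.lt_top w (hsΩ hws)).ne hw).symm
    rw [hEw, hEz]
    exact sq_exp_sub_exp_le _ _
  have hA : Integrable (fun w => (E w - E z) ^ 2 + E z ^ 2) (volume.restrict (Metric.ball z r)) :=
    hdi.add (hci _)
  have hD : Integrable (fun w => (V w).toReal - (V z).toReal) (volume.restrict (Metric.ball z r)) :=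
    hint.sub (hci _)
  rw [integral_add hA (hD.const_mul _), integral_add hdi (hci _),
    integral_const_mul, integral_sub hint (hci _), setIntegral_const, setIntegral_const,
    smul_eq_mul, smul_eq_mul] at key
  have h3 : 0 ≤ 2 * E z ^ 2 * ((∫ w in Metric.ball z r, (V w).toReal) -
      volume.real (Metric.ball z r) * (V z).toReal) :=
    mul_nonneg (by positivity) (by linarith)
  linarith

/-- An almost everywhere defined bound for the growth of `exp V` holds everywhere. -/
theorem IsSubharmonic.expOn_le_of_ae {Ω : TopologicalSpace.Opens ℂ}
    (hV : IsSubharmonic Ω V) (hs : IsOpen s) (hsΩ : s ⊆ Ω) {ρ L : ℝ} (hρ : 0 < ρ)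
    (hρs : Metric.ball 0 ρ ⊆ s) (hL : 0 ≤ L)
    (h : ∀ᵐ h ∂volume.restrict (Metric.ball (0 : ℂ) ρ),
      ∀ᵐ z ∂volume.restrict (Metric.ball (0 : ℂ) ρ),
      expOn s V (z + h) ≤ Real.exp (L * ‖h‖) * expOn s V z) {z z' : ℂ}
    (hz : z ∈ Metric.ball (0 : ℂ) (ρ / 4)) (hz' : z' ∈ Metric.ball (0 : ℂ) (ρ / 4)) :
    expOn s V z' ≤ Real.exp (L * ‖z' - z‖) * expOn s V z := by
  set E := expOn s V with hE
  rw [mem_ball_zero_iff] at hz hz'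
  have hzs : z ∈ s := hρs (by rw [mem_ball_zero_iff]; linarith)
  have hzs' : z' ∈ s := hρs (by rw [mem_ball_zero_iff]; linarith)
  have key : ∀ η > 0, E z' ≤ Real.exp (L * (‖z' - z‖ + η)) * (E z + η) := by
    intro η hη
    have hE0 : 0 ≤ E z := expOn_nonneg z
    -- Adding `η` gives a real bound strictly above `V z`, even when `V z = ⊥`, so that upper
    -- semicontinuity extends it to a disc about `z`.
    set a := Real.log (E z + η) with ha
    have hexpa : Real.exp a = E z + η := Real.exp_log (by linarith)
    have hVa : V z < a := by
      by_contra! hcon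
      have hb : V z ≠ ⊥ := fun hb => by rw [hb] at hcon; simp at hcon
      have hcoe := EReal.coe_toReal (hV.lt_top z (hsΩ hzs)).ne hb
      rw [← hcoe, EReal.coe_le_coe_iff] at hcon
      have := expOn_of_eq_coe hzs hcoe.symm
      have h2 := Real.exp_le_exp.2 hcon
      rw [hexpa, ← this] at h2
      linarith
    have husc : ∀ᶠ y in 𝓝 z, V y < a := by
      have := hV.upperSemicontinuousOn z (hsΩ hzs) a hVa
      rwa [Ω.isOpen.nhdsWithin_eq (hsΩ hzs)] at this
    obtain ⟨δ₀, hδ₀, hsub⟩ := Metric.eventually_nhds_iff_ball.1 husc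
    obtain ⟨r₀, hr₀, hr₀s⟩ := Metric.nhds_basis_closedBall.mem_iff.1 (hs.mem_nhds hzs')
    set δ := min (min (δ₀ / 2) η) (min (ρ / 4) r₀) with hδ
    have hδ0 : 0 < δ := lt_min (lt_min (by linarith) hη) (lt_min (by linarith) hr₀)
    have hδ1 : δ ≤ δ₀ / 2 := (min_le_left _ _).trans (min_le_left _ _)
    have hδ2 : δ ≤ η := (min_le_left _ _).trans (min_le_right _ _)
    have hδ3 : δ ≤ ρ / 4 := (min_le_right _ _).trans (min_le_left _ _)
    have hδ4 : δ ≤ r₀ := (min_le_right _ _).trans (min_le_right _ _)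
    have hballs : Metric.ball (z' - z) δ ⊆ Metric.ball 0 ρ := by
      intro x hx
      rw [mem_ball_iff_norm] at hx
      rw [mem_ball_zero_iff]
      have h1 : x = (x - (z' - z)) + (z' - z) := by ring
      rw [h1]
      linarith [norm_add_le (x - (z' - z)) (z' - z), norm_sub_le z' z]
    have : NeBot (ae (volume.restrict (Metric.ball (z' - z) δ))) := by
      rw [ae_neBot, Ne, Measure.restrict_eq_zero]
      exact (Metric.measure_ball_pos volume _ hδ0).ne'
    -- A good displacement within `δ` of `z' - z`: for almost every `w` within `δ` of `z'`, the
    -- bound compares `w` with `w - h₀`, which lies within `2δ` of `z`.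
    obtain ⟨h₀, hh₀, hh₀b⟩ := ((ae_restrict_of_ae_restrict_of_subset hballs h).and
      (ae_restrict_mem Metric.isOpen_ball.measurableSet)).exists
    rw [ae_restrict_iff' Metric.isOpen_ball.measurableSet] at hh₀
    have htr := (measurePreserving_sub_right volume h₀).quasiMeasurePreserving.ae hh₀
    rw [mem_ball_iff_norm] at hh₀b
    have hbound : ∀ᵐ w ∂volume.restrict (Metric.ball z' δ),
        E w ≤ Real.exp (L * (‖z' - z‖ + η)) * (E z + η) := by
      rw [ae_restrict_iff' Metric.isOpen_ball.measurableSet]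
      filter_upwards [htr] with w hw hwb
      rw [mem_ball_iff_norm] at hwb
      have hdist : ‖w - h₀ - z‖ < 2 * δ := by
        have : w - h₀ - z = (w - z') - (h₀ - (z' - z)) := by ring
        rw [this]
        linarith [norm_sub_le (w - z') (h₀ - (z' - z))]
      have hmem : w - h₀ ∈ Metric.ball (0 : ℂ) ρ := by
        rw [mem_ball_zero_iff]
        have : w - h₀ = (w - h₀ - z) + z := by ring
        rw [this]
        linarith [norm_add_le (w - h₀ - z) z]
      have h1 := hw hmem
      rw [sub_add_cancel] at h1
      have h2 : E (w - h₀) ≤ E z + η := by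
        rw [← hexpa]
        refine expOn_le_exp (hsub _ ?_).le
        rw [mem_ball_iff_norm]; linarith
      have h3 : ‖h₀‖ ≤ ‖z' - z‖ + η := by
        have : h₀ = (h₀ - (z' - z)) + (z' - z) := by ring
        rw [this]
        linarith [norm_add_le (h₀ - (z' - z)) (z' - z)]
      refine h1.trans (mul_le_mul (Real.exp_le_exp.2 (mul_le_mul_of_nonneg_left h3 hL)) h2
        (expOn_nonneg _) (Real.exp_nonneg _))
    set M := Real.exp (L * (‖z' - z‖ + η)) * (E z + η) with hM
    have hM0 : 0 < M := by positivity
    by_cases hb : V z' = ⊥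
    · rw [hE, expOn_of_eq_bot hb]; exact hM0.le
    have hcl : Metric.closedBall z' δ ⊆ s := (Metric.closedBall_subset_closedBall hδ4).trans hr₀s
    obtain ⟨hae, hint, hle⟩ := hV.ball_submean hδ0 (hcl.trans hsΩ) hb
    have hvol : 0 < volume.real (Metric.ball z' δ) :=
      ENNReal.toReal_pos (Metric.measure_ball_pos volume z' hδ0).ne' measure_ball_lt_top.ne
    -- The bound on `V` almost everywhere near `z'` passes to `z'` itself by the sub-mean value
    -- inequality.
    have hmono : ∫ y in Metric.ball z' δ, (V y).toReal ≤ ∫ _y in Metric.ball z' δ, Real.log M := by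
      refine integral_mono_ae hint (integrableOn_const measure_ball_lt_top.ne) ?_
      filter_upwards [hbound, hae, ae_restrict_mem Metric.isOpen_ball.measurableSet] with y h1 h2 h3
      have hys := hcl (Metric.ball_subset_closedBall h3)
      have := expOn_of_eq_coe hys (EReal.coe_toReal (hV.lt_top y (hsΩ hys)).ne h2).symm
      rw [hE, this] at h1
      exact (Real.le_log_iff_exp_le hM0).2 h1
    rw [setIntegral_const, smul_eq_mul] at hmono
    have hfin := le_of_mul_le_mul_left (hle.trans hmono) hvol
    have := expOn_of_eq_coe hzs' (EReal.coe_toReal (hV.lt_top z' (hsΩ hzs')).ne hb).symm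
    rw [hE, this]
    exact (Real.le_log_iff_exp_le hM0).1 hfin
  have hlim : Tendsto (fun η : ℝ => Real.exp (L * (‖z' - z‖ + η)) * (E z + η)) (𝓝[>] 0)
      (𝓝 (Real.exp (L * (‖z' - z‖ + 0)) * (E z + 0))) := by
    refine Tendsto.mono_left ?_ nhdsWithin_le_nhds
    exact Continuous.tendsto (by fun_prop) 0
  rw [add_zero, add_zero] at hlim
  refine ge_of_tendsto hlim ?_
  filter_upwards [self_mem_nhdsWithin] with η hη
  exact key η hη

theorem exists_norm_fderiv_le {k : ℕ} {H : Fin k → ℂ → ℝ}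
    (hH : ∀ i, InnerProductSpace.HarmonicOnNhd (H i) (Metric.ball 0 R)) {r : ℝ} (hr : r < R) :
    ∃ L : ℝ, 0 ≤ L ∧ ∀ i, ∀ z ∈ Metric.closedBall (0 : ℂ) r, ‖fderiv ℝ (H i) z‖ ≤ L := by
  have hex : ∀ i, ∃ L : ℝ, ∀ z ∈ Metric.closedBall (0 : ℂ) r, ‖fderiv ℝ (H i) z‖ ≤ L := by
    intro i
    refine (isCompact_closedBall (0 : ℂ) r).exists_bound_of_continuousOn fun w hw => ?_
    have := (hH i w (Metric.closedBall_subset_ball hr hw)).1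
    exact (this.fderiv_right (m := 1) (by norm_num)).continuousAt.continuousWithinAt
  choose L hL using hex
  refine ⟨∑ i, |L i|, Finset.sum_nonneg fun i _ => abs_nonneg _, fun i z hz => ?_⟩
  refine (hL i z hz).trans ((le_abs_self _).trans ?_)
  exact Finset.single_le_sum (f := fun i => |L i|) (fun i _ => abs_nonneg _) (Finset.mem_univ i)

/-- A subharmonic function whose derivative is piecewise holomorphic off a null set is Lipschitz
continuous near the origin. -/
theorem exists_lipschitz (hR : 0 < R) (hV : IsSH₀ (disc R) V) {k : ℕ} {g : Fin k → ℂ → ℂ}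
    (hg : IsPiecewiseHolomorphicDz (disc R) V g) {H : Fin k → ℂ → ℝ}
    (hH : ∀ i, InnerProductSpace.HarmonicOnNhd (H i) (Metric.ball 0 R))
    (hHg : ∀ i, ∀ z ∈ Metric.ball (0 : ℂ) R, dz (H i) z = g i z) :
    ∃ ρ > 0, ρ < R ∧ ∃ L : ℝ, 0 ≤ L ∧ ∃ f : ℂ → ℝ,
      (∀ z ∈ Metric.ball (0 : ℂ) ρ, V z = f z) ∧
      ∀ z ∈ Metric.ball (0 : ℂ) ρ, ∀ w ∈ Metric.ball (0 : ℂ) ρ, |f z - f w| ≤ L * ‖z - w‖ := by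
  have hS := hV.isSubharmonic
  -- The factor 6 keeps the closed disc of radius `5ρ`, outside which `E` is set to zero, inside the
  -- domain.
  set ρ := R / 6 with hρ
  have hρ0 : 0 < ρ := by positivity
  set s := Metric.ball (0 : ℂ) (5 * ρ) with hs
  have hso : IsOpen s := Metric.isOpen_ball
  have hcR : Metric.closedBall (0 : ℂ) (5 * ρ) ⊆ (disc R : Set ℂ) :=
    Metric.closedBall_subset_ball (by rw [hρ]; linarith)
  have hsR : s ⊆ (disc R : Set ℂ) := Metric.ball_subset_closedBall.trans hcR
  obtain ⟨L, hL, hfd⟩ := exists_norm_fderiv_le hH (r := 5 * ρ) (by rw [hρ]; linarith)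
  obtain ⟨C, hC, hVC⟩ := hS.exists_bound (isCompact_closedBall (0 : ℂ) (5 * ρ)) hcR
  set E := expOn s V with hE
  have hEm : Measurable E := hS.measurable_expOn hso.measurableSet hsR
  have hsupp : ∀ z, z ∉ s → E z = 0 := fun z hz => indicator_of_notMem hz _
  have hB : ∀ z, |E z| ≤ Real.exp C := by
    intro z
    rw [abs_of_nonneg (expOn_nonneg z)]
    by_cases hz : z ∈ s
    · exact expOn_le_exp (hVC z (Metric.ball_subset_closedBall hz))
    · exact (hsupp z hz).le.trans (Real.exp_nonneg _)
  obtain ⟨C', hC', henergy⟩ := exists_lintegral_sq_sub_le hEm hρ0 hB hsupp (by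
    intro r hr hrρ
    filter_upwards [hS.ae_ne_bot isPreconnected_disc] with z hz hzb
    rw [mem_ball_zero_iff] at hzb
    refine hS.lintegral_sq_expOn_sub_le hso hsR hB hr ?_ (hz (hsR ?_))
    · refine (Metric.closedBall_subset_ball' (ε₂ := 5 * ρ) ?_)
      rw [dist_zero_right]; linarith
    · rw [hs, mem_ball_zero_iff]; linarith)
  -- Compactness is needed for neighbourhoods of `K` to have small area. Radius `4ρ` suffices, as
  -- segments from `|z| < 2ρ` with increment less than `ρ` stay in `|z| < 3ρ`.
  set K := Metric.closedBall (0 : ℂ) (4 * ρ) ∩ Distribution.dsupport (distLaplacian (disc R) V)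
    with hKdef
  have hK : IsCompact K := (isCompact_closedBall _ _).inter_right Distribution.isClosed_dsupport
  have hK0 : volume K = 0 := by
    refine measure_mono_null ?_ hV.volume_suppLaplacian
    exact inter_subset_inter_left _
      ((Metric.closedBall_subset_closedBall (by linarith)).trans hcR)
  have hae := ae_le_exp_mul_of_energy hEm (fun z => expOn_nonneg z) hρ0 hL hC' henergy hK hK0 (by
    intro z hz v hv hseg
    rw [mem_ball_zero_iff] at hz hv
    have hnorm : ∀ t ∈ Icc (0 : ℝ) 1, ‖z + t • v‖ < 4 * ρ := by
      intro t ht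
      have : ‖t • v‖ ≤ ‖v‖ := by
        rw [norm_smul, Real.norm_of_nonneg ht.1]
        exact mul_le_of_le_one_left (norm_nonneg _) ht.2
      linarith [norm_add_le z (t • v)]
    have hloc : ∀ t ∈ Icc (0 : ℝ) 1, V (z + t • v) = ((V (z + t • v)).toReal : EReal) ∧
        ∃ d, HasDerivWithinAt (fun t : ℝ => (V (z + t • v)).toReal) d (Icc 0 1) t ∧
          ‖d‖ ≤ L * ‖v‖ := by
      intro t ht
      set x := z + t • v with hx
      have hxD : x ∈ (disc R : Set ℂ) \ suppLaplacian (disc R) V := by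
        refine ⟨hcR (by rw [mem_closedBall_zero_iff]; linarith [hnorm t ht]), fun hxs => ?_⟩
        exact hseg t ht ⟨by rw [mem_closedBall_zero_iff]; exact (hnorm t ht).le, hxs.2⟩
      obtain ⟨i, hi⟩ := hg.exists_eq x hxD
      obtain ⟨r, hr, c, hVH⟩ := exists_ball_of_mem_activeSet hS (hH i) (hHg i) ⟨hxD, hi⟩
      have h1 := hVH x (Metric.mem_ball_self hr)
      refine ⟨by rw [h1, EReal.toReal_coe], fderiv ℝ (H i) x v, ?_, ?_⟩
      · have hd : HasFDerivAt (H i) (fderiv ℝ (H i) x) x :=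
          ((hH i x hxD.1).1.differentiableAt (by norm_num)).hasFDerivAt
        have hpath : HasDerivAt (fun t : ℝ => z + t • v) v t := by
          simpa using ((hasDerivAt_id t).smul_const v).const_add z
        have hcomp : HasDerivAt (fun t : ℝ => H i (z + t • v) + c) (fderiv ℝ (H i) x v) t :=
          (hd.comp_hasDerivAt t hpath).add_const c
        refine (hcomp.congr_of_eventuallyEq ?_).hasDerivWithinAt
        have hcont : ContinuousAt (fun t : ℝ => z + t • v) t := hpath.continuousAt
        filter_upwards [hcont (Metric.ball_mem_nhds x hr)] with t' ht'
        rw [hVH _ ht', EReal.toReal_coe]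
      · refine ((fderiv ℝ (H i) x).le_opNorm v).trans ?_
        refine mul_le_mul_of_nonneg_right (hfd i x ?_) (norm_nonneg _)
        rw [mem_closedBall_zero_iff]; linarith [hnorm t ht]
    choose! d hd using fun t ht => (hloc t ht).2
    have hmv := norm_image_sub_le_of_norm_deriv_le_segment_01'
      (f := fun t : ℝ => (V (z + t • v)).toReal) (f' := d) (fun t ht => (hd t ht).1)
      (fun t ht => (hd t (Ico_subset_Icc_self ht)).2)
    have h0 := (hloc 0 ⟨le_rfl, zero_le_one⟩).1
    have h1 := (hloc 1 ⟨zero_le_one, le_rfl⟩).1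
    simp only [zero_smul, one_smul, add_zero] at hmv h0 h1
    have hzs : z ∈ s := by rw [hs, mem_ball_zero_iff]; linarith
    have hzvs : z + v ∈ s := by
      rw [hs, mem_ball_zero_iff]; linarith [norm_add_le z v]
    rw [hE, expOn_of_eq_coe hzs h0, expOn_of_eq_coe hzvs h1, ← Real.exp_add, Real.exp_le_exp]
    linarith [le_of_abs_le hmv])
  have hEle : ∀ z ∈ Metric.ball (0 : ℂ) (ρ / 4), ∀ z' ∈ Metric.ball (0 : ℂ) (ρ / 4),
      E z' ≤ Real.exp (L * ‖z' - z‖) * E z := fun z hz z' hz' =>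
    hS.expOn_le_of_ae hso hsR hρ0 (Metric.ball_subset_ball (by linarith)) hL hae hz hz'
  have hsub : Metric.ball (0 : ℂ) (ρ / 4) ⊆ s := Metric.ball_subset_ball (by linarith)
  have : NeBot (ae (volume.restrict (Metric.ball (0 : ℂ) (ρ / 4)))) := by
    rw [ae_neBot, Ne, Measure.restrict_eq_zero]
    exact (Metric.measure_ball_pos volume _ (by linarith)).ne'
  -- A single point where `V` is finite excludes the value `⊥` throughout the disc: at such a point
  -- `E` would be zero and bound `E a > 0` from above.
  obtain ⟨a, ha, hab⟩ := ((ae_restrict_of_ae (hS.ae_ne_bot isPreconnected_disc)).and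
    (ae_restrict_mem (s := Metric.ball (0 : ℂ) (ρ / 4)) Metric.isOpen_ball.measurableSet)).exists
  have hcoe : ∀ z ∈ Metric.ball (0 : ℂ) (ρ / 4), V z = ((V z).toReal : EReal) := by
    intro z hz
    refine (EReal.coe_toReal (hS.lt_top z (hsR (hsub hz))).ne fun hb => ?_).symm
    have h1 := hEle z hz a hab
    rw [hE, expOn_of_eq_bot hb, mul_zero, expOn_of_eq_coe (hsub hab)
      (EReal.coe_toReal (hS.lt_top a (hsR (hsub hab))).ne (ha (hsR (hsub hab)))).symm] at h1
    exact absurd h1 (not_le.2 (Real.exp_pos _))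
  have hone : ∀ z ∈ Metric.ball (0 : ℂ) (ρ / 4), ∀ z' ∈ Metric.ball (0 : ℂ) (ρ / 4),
      (V z').toReal - (V z).toReal ≤ L * ‖z' - z‖ := by
    intro z hz z' hz'
    have h1 := hEle z hz z' hz'
    rw [hE, expOn_of_eq_coe (hsub hz) (hcoe z hz), expOn_of_eq_coe (hsub hz') (hcoe z' hz'),
      ← Real.exp_add, Real.exp_le_exp] at h1
    linarith
  refine ⟨ρ / 4, by linarith, by rw [hρ]; linarith, L, hL, fun z => (V z).toReal, hcoe, ?_⟩
  intro z hz w hw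
  refine abs_le.2 ⟨?_, hone w hw z hz⟩
  have := hone z hz w hw
  rw [norm_sub_rev] at this
  linarith

end SubharmonicConfiguration

/-! ### Integration along segments and the strong maximum principle -/

namespace SubharmonicConfiguration

/-- By Fubini the order may be exchanged: for fixed `s > 0` the exceptional `y` form a homothetic
image of `K`, hence a null set. -/
theorem ae_ae_segment_notMem {K : Set ℂ} (hK : volume K = 0) (p : ℂ) :
    ∀ᵐ y : ℂ, ∀ᵐ s ∂volume.restrict (Ioo (0 : ℝ) 1), p + s • (y - p) ∉ K := by
  set K' := toMeasurable volume K with hK'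
  have hK'm : MeasurableSet K' := measurableSet_toMeasurable _ _
  have hK'0 : volume K' = 0 := by rw [hK', measure_toMeasurable, hK]
  have hmeas : MeasurableSet {x : ℂ × ℝ | p + x.2 • (x.1 - p) ∉ K'} := by
    have : Continuous fun x : ℂ × ℝ => p + x.2 • (x.1 - p) := by fun_prop
    exact (this.measurable hK'm).compl
  have h1 : ∀ᵐ y : ℂ, ∀ᵐ s ∂volume.restrict (Ioo (0 : ℝ) 1), p + s • (y - p) ∉ K' := by
    rw [Measure.ae_ae_comm hmeas]
    filter_upwards [ae_restrict_mem measurableSet_Ioo] with s hs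
    rw [ae_iff]
    simp only [not_not]
    have : {y | p + s • (y - p) ∈ K'} =
        (fun y => -p + y) ⁻¹' ((fun y => s • y) ⁻¹' ((fun y => p + y) ⁻¹' K')) := by
      ext y; simp only [mem_ofPred_eq, mem_preimage, neg_add_eq_sub]
    rw [this, measure_preimage_add, Measure.addHaar_preimage_smul _ hs.1.ne', measure_preimage_add,
      hK'0, mul_zero]
  filter_upwards [h1] with y hy
  filter_upwards [hy] with s hs hsK
  exact hs (subset_toMeasurable _ _ hsK)

/-- If a Lipschitz function has nonpositive derivative, off a null set, along the segments from `p`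
to the points of an open set, then its values in this open set are at most its value at `p`. -/
theorem le_of_deriv_segment_nonpos {f : ℂ → ℝ} {ρ L : ℝ} (hL : 0 ≤ L)
    (hf : ∀ z ∈ Metric.ball (0 : ℂ) ρ, ∀ w ∈ Metric.ball (0 : ℂ) ρ, |f z - f w| ≤ L * ‖z - w‖)
    {K : Set ℂ} (hK : volume K = 0) {p : ℂ} (hp : p ∈ Metric.ball (0 : ℂ) ρ) {O : Set ℂ}
    (hO : IsOpen O) (hOρ : O ⊆ Metric.ball 0 ρ)
    (h : ∀ y ∈ O, ∀ s ∈ Ioo (0 : ℝ) 1, p + s • (y - p) ∉ K → ∀ d,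
      HasDerivAt (fun s : ℝ => f (p + s • (y - p))) d s → d ≤ 0) :
    ∀ y ∈ O, f y ≤ f p := by
  have hae : ∀ᵐ y : ℂ, y ∈ O → f y ≤ f p := by
    filter_upwards [ae_ae_segment_notMem hK p] with y hy hyO
    have hmem : ∀ s ∈ Icc (0 : ℝ) 1, p + s • (y - p) ∈ Metric.ball (0 : ℂ) ρ := fun s hs =>
      (convex_ball (0 : ℂ) ρ).add_smul_sub_mem hp (hOρ hyO) hs
    have hlip : LipschitzOnWith (Real.toNNReal (L * ‖y - p‖)) (fun s : ℝ => f (p + s • (y - p)))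
        (uIcc 0 1) := by
      rw [uIcc_of_le zero_le_one]
      refine LipschitzOnWith.of_dist_le_mul fun s hs t ht => ?_
      rw [Real.coe_toNNReal _ (by positivity), Real.dist_eq, Real.dist_eq]
      refine (hf _ (hmem s hs) _ (hmem t ht)).trans (le_of_eq ?_)
      rw [add_sub_add_left_eq_sub, ← sub_smul, norm_smul, Real.norm_eq_abs]
      ring
    -- A Lipschitz function is absolutely continuous along the segment, so it is the integral of its
    -- derivative and the null set of parameters in `K` does not matter. Where it is not
    -- differentiable, `deriv` is zero by convention, which also has the required sign.
    have hint := hlip.absolutelyContinuousOnInterval.integral_deriv_eq_sub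
    simp only [one_smul, zero_smul, add_zero, add_sub_cancel] at hint
    have hneg : ∫ s in (0 : ℝ)..1, deriv (fun s : ℝ => f (p + s • (y - p))) s ≤ 0 := by
      rw [intervalIntegral.integral_of_le zero_le_one, integral_Ioc_eq_integral_Ioo]
      refine integral_nonpos_of_ae ?_
      filter_upwards [hy, ae_restrict_mem measurableSet_Ioo] with s hs hs1
      by_cases hd : DifferentiableAt ℝ (fun s : ℝ => f (p + s • (y - p))) s
      · exact h y hyO s hs1 hs _ hd.hasDerivAt
      · rw [deriv_zero_of_not_differentiableAt hd]; rfl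
    linarith
  intro y hy
  by_contra! hlt
  have hcont : ContinuousOn f (Metric.ball 0 ρ) := by
    have : LipschitzOnWith (Real.toNNReal L) f (Metric.ball 0 ρ) := by
      refine LipschitzOnWith.of_dist_le_mul fun z hz w hw => ?_
      rw [Real.coe_toNNReal _ hL, Real.dist_eq, dist_eq_norm]
      exact hf z hz w hw
    exact this.continuousOn
  have hev : ∀ᶠ w in 𝓝 y, f p < f w ∧ w ∈ O :=
    ((hcont.continuousAt (Metric.isOpen_ball.mem_nhds (hOρ hy))).eventually
      (lt_mem_nhds hlt)).and (hO.mem_nhds hy)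
  obtain ⟨r, hr, hsub⟩ := Metric.eventually_nhds_iff_ball.1 hev
  have : NeBot (ae (volume.restrict (Metric.ball y r))) := by
    rw [ae_neBot, Ne, Measure.restrict_eq_zero]
    exact (Metric.measure_ball_pos volume _ hr).ne'
  obtain ⟨w, hw, hwb⟩ := ((ae_restrict_of_ae hae).and
    (ae_restrict_mem (s := Metric.ball y r) Metric.isOpen_ball.measurableSet)).exists
  obtain ⟨h1, h2⟩ := hsub w hwb
  exact absurd (hw h2) (not_le.2 h1)

theorem circleMean_eq_circleAverage {V : ℂ → EReal} {f : ℂ → ℝ} {z : ℂ} {r : ℝ} (hr : 0 ≤ r)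
    (hVf : ∀ w ∈ Metric.sphere z r, V w = f w) (hf : ContinuousOn f (Metric.sphere z r)) :
    circleMean V z r = (Real.circleAverage f z r : ℝ) := by
  have hcs : ∀ θ, circleMap z r θ ∈ Metric.sphere z r := fun θ => circleMap_mem_sphere z hr θ
  have hcont : Continuous fun θ => f (circleMap z r θ) :=
    hf.comp_continuous (continuous_circleMap z r) hcs
  have hint : Integrable (fun θ => f (circleMap z r θ)) (volume.restrict (Ioc 0 (2 * Real.pi))) :=
    (hcont.integrableOn_Icc).mono_set Ioc_subset_Icc_self
  have hvol : volume (Ioc 0 (2 * Real.pi)) = ENNReal.ofReal (2 * Real.pi) := by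
    rw [Real.volume_Ioc, sub_zero]
  have h2pi : 0 < 2 * Real.pi := by positivity
  have hp : ∫⁻ θ in Ioc 0 (2 * Real.pi), ENNReal.ofReal (f (circleMap z r θ)) ≠ ⊤ :=
    hint.lintegral_lt_top.ne
  have hq : ∫⁻ θ in Ioc 0 (2 * Real.pi), ENNReal.ofReal (-f (circleMap z r θ)) ≠ ⊤ :=
    hint.neg.lintegral_lt_top.ne
  have e1 : ∀ θ, (V (circleMap z r θ)).toENNReal = ENNReal.ofReal (f (circleMap z r θ)) := by
    intro θ
    rw [hVf _ (hcs θ), EReal.toENNReal_of_ne_top (EReal.coe_ne_top _), EReal.toReal_coe]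
  have e2 : ∀ θ, (-V (circleMap z r θ)).toENNReal = ENNReal.ofReal (-f (circleMap z r θ)) := by
    intro θ
    rw [hVf _ (hcs θ), ← EReal.coe_neg, EReal.toENNReal_of_ne_top (EReal.coe_ne_top _),
      EReal.toReal_coe]
  have hne : ENNReal.ofReal (2 * Real.pi) ≠ 0 := by simp [Real.pi_pos]
  unfold circleMean
  simp only [e1, e2]
  rw [setLAverage_eq, setLAverage_eq, hvol, Real.circleAverage_def,
    intervalIntegral.integral_of_le h2pi.le,
    integral_eq_lintegral_pos_part_sub_lintegral_neg_part hint,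
    ← EReal.coe_ennreal_toReal (ENNReal.div_ne_top hp hne),
    ← EReal.coe_ennreal_toReal (ENNReal.div_ne_top hq hne), ← EReal.coe_sub,
    ENNReal.toReal_div, ENNReal.toReal_div, ENNReal.toReal_ofReal h2pi.le]
  congr 1
  rw [smul_eq_mul]
  ring

variable {R : ℝ} {V : ℂ → EReal}

/-- The strong maximum principle for the difference of a continuous subharmonic function and a
harmonic function. -/
theorem IsSubharmonic.eq_of_isMax (hV : IsSubharmonic (disc R) V) {f H : ℂ → ℝ} {ρ : ℝ}
    (hρR : ρ ≤ R) (hVf : ∀ z ∈ Metric.ball (0 : ℂ) ρ, V z = f z)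
    (hfc : ContinuousOn f (Metric.ball 0 ρ))
    (hH : InnerProductSpace.HarmonicOnNhd H (Metric.ball 0 R)) {O : Set ℂ} (hO : IsOpen O)
    (hOc : IsPreconnected O) (hOρ : O ⊆ Metric.ball 0 ρ) {c : ℝ} (hle : ∀ y ∈ O, f y - H y ≤ c)
    {z₀ : ℂ} (hz₀ : z₀ ∈ O) (hz₀c : f z₀ - H z₀ = c) : ∀ y ∈ O, f y - H y = c := by
  have hOR : O ⊆ Metric.ball 0 R := hOρ.trans (Metric.ball_subset_ball hρR)
  have hHc : ∀ w ∈ O, ContinuousAt H w := fun w hw => (hH w (hOR hw)).1.continuousAt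
  have hfca : ∀ w ∈ O, ContinuousAt f w := fun w hw =>
    hfc.continuousAt (Metric.isOpen_ball.mem_nhds (hOρ hw))
  -- If the difference were below `c` at some `w` near `y`, its mean over the circle about `y`
  -- through `w` would be below `c`, against sub-mean value for `f` and mean value for `H`.
  have hloc : ∀ y ∈ O, f y - H y = c → ∃ r > 0, ∀ w ∈ Metric.ball y r, w ∈ O ∧ f w - H w = c := by
    intro y hy hyc
    obtain ⟨r, hr, hsub⟩ := Metric.isOpen_iff.1 hO y hy
    refine ⟨r, hr, fun w hw => ⟨hsub hw, ?_⟩⟩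
    by_contra hne
    have hlt : f w - H w < c := lt_of_le_of_ne (hle w (hsub hw)) hne
    set s := dist w y with hs
    have hs0 : 0 < s := by
      rw [hs, dist_pos]; rintro rfl; exact hne hyc
    have hclO : Metric.closedBall y s ⊆ O := (Metric.closedBall_subset_ball hw).trans hsub
    have hspO : Metric.sphere y s ⊆ O := Metric.sphere_subset_closedBall.trans hclO
    have hcs : ∀ θ, circleMap y s θ ∈ O := fun θ => hspO (circleMap_mem_sphere y hs0.le θ)
    have hfcirc : Continuous fun θ => f (circleMap y s θ) := continuous_iff_continuousAt.2 fun θ =>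
      ContinuousAt.comp (hfca _ (hcs θ)) (continuous_circleMap y s).continuousAt
    have hHcirc : Continuous fun θ => H (circleMap y s θ) := continuous_iff_continuousAt.2 fun θ =>
      ContinuousAt.comp (hHc _ (hcs θ)) (continuous_circleMap y s).continuousAt
    have hmean : f y ≤ Real.circleAverage f y s := by
      have h1 := hV.le_circleMean y s hs0 (hclO.trans hOR)
      rw [circleMean_eq_circleAverage hs0.le (fun w hw => hVf w (hOρ (hspO hw)))
        (fun w hw => (hfca w (hspO hw)).continuousWithinAt), hVf y (hOρ hy)] at h1
      exact_mod_cast h1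
    have hHmean : Real.circleAverage H y s = H y := by
      refine InnerProductSpace.HarmonicOnNhd.circleAverage_eq fun w hw => hH w (hOR (hclO ?_))
      rwa [abs_of_pos hs0] at hw
    have h2pi : 0 < 2 * Real.pi := by positivity
    have hint : ∫ θ in 0..2 * Real.pi, (f (circleMap y s θ) - H (circleMap y s θ)) <
        ∫ _θ in 0..2 * Real.pi, c := by
      refine intervalIntegral.integral_lt_integral_of_continuousOn_of_le_of_exists_lt h2pi
        (hfcirc.sub hHcirc).continuousOn continuousOn_const (fun θ _ => hle _ (hcs θ)) ?_
      have hws : w ∈ circleMap y s '' Ioc 0 (2 * Real.pi) := by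
        rw [image_circleMap_Ioc, abs_of_pos hs0, Metric.mem_sphere]
      obtain ⟨θ, hθ, hθw⟩ := hws
      exact ⟨θ, Ioc_subset_Icc_self hθ, by rw [hθw]; exact hlt⟩
    rw [intervalIntegral.integral_sub (hfcirc.intervalIntegrable _ _)
      (hHcirc.intervalIntegrable _ _), intervalIntegral.integral_const, sub_zero, smul_eq_mul] at hint
    rw [Real.circleAverage_def, smul_eq_mul] at hmean hHmean
    have e1 : ∀ x : ℝ, (2 * Real.pi)⁻¹ * x * (2 * Real.pi) = x := fun x => by field_simp
    have h3 := mul_le_mul_of_nonneg_right hmean h2pi.le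
    have h4 := congrArg (· * (2 * Real.pi)) hHmean
    simp only [e1] at h3 h4
    nlinarith
  set u : Set ℂ := {y | y ∈ O ∧ f y - H y = c} with hu
  have huo : IsOpen u := by
    rw [Metric.isOpen_iff]
    rintro y ⟨hy, hyc⟩
    obtain ⟨r, hr, h⟩ := hloc y hy hyc
    exact ⟨r, hr, fun w hw => h w hw⟩
  have hsub : O ⊆ u := by
    refine hOc.subset_of_closure_inter_subset huo ⟨z₀, hz₀, hz₀, hz₀c⟩ ?_
    rintro y ⟨hy, hyO⟩
    refine ⟨hyO, ?_⟩
    have hcont : ContinuousAt (fun w => f w - H w) y := (hfca y hyO).sub (hHc y hyO)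
    have hne : NeBot (𝓝[u] y) := mem_closure_iff_nhdsWithin_neBot.1 hy
    refine tendsto_nhds_unique (hcont.tendsto.mono_left (nhdsWithin_le_nhds (s := u))) ?_
    refine tendsto_const_nhds.congr' ?_
    filter_upwards [self_mem_nhdsWithin] with w hw
    exact hw.2.symm
  exact fun y hy => (hsub hy).2

end SubharmonicConfiguration

/-! ### Linear functionals on convex polygons -/

namespace SubharmonicConfiguration

theorem continuousLinearMap_apply_eq_re_mul (T : ℂ →L[ℝ] ℝ) (z : ℂ) :
    T z = (z * (T 1 - Complex.I * T Complex.I)).re := by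
  have hv : z = z.re • (1 : ℂ) + z.im • Complex.I := by
    apply Complex.ext <;> simp
  conv_lhs => rw [hv, map_add, map_smul, map_smul]
  simp

/-- Removing an extreme point leaves a convex set, so the point is outside the hull of the others,
which is compact, and Hahn–Banach separates strictly. Separation puts the point on the lower side,
whence the minus sign in the witness. -/
theorem exists_re_mul_lt_of_mem_extremePoints {k : ℕ} {a : Fin k → ℂ} {j : Fin k}
    (hj : a j ∈ (convexHull ℝ (range a)).extremePoints ℝ) (hne : ∀ i, i ≠ j → a i ≠ a j) :
    ∃ e : ℂ, ∀ i, i ≠ j → (a i * e).re < (a j * e).re := by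
  set S : Set ℂ := a '' {i | i ≠ j} with hS
  have hfin : S.Finite := (Set.toFinite _).image a
  have hnot : a j ∉ convexHull ℝ S := by
    intro hmem
    have hconv := ((convex_convexHull ℝ (range a)).mem_extremePoints_iff_convex_sdiff.1 hj).2
    have hsub : S ⊆ convexHull ℝ (range a) \ {a j} := by
      rintro _ ⟨i, hi, rfl⟩
      exact ⟨subset_convexHull ℝ _ (mem_range_self i), hne i hi⟩
    exact (convexHull_min hsub hconv hmem).2 rfl
  obtain ⟨T, u, hT1, hT2⟩ := geometric_hahn_banach_point_closed (convex_convexHull ℝ S)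
    (hfin.isCompact_convexHull ℝ).isClosed hnot
  refine ⟨-(T 1 - Complex.I * T Complex.I), fun i hi => ?_⟩
  have h1 := hT2 (a i) (subset_convexHull ℝ _ ⟨i, hi, rfl⟩)
  rw [continuousLinearMap_apply_eq_re_mul] at hT1 h1
  rw [mul_neg, mul_neg, Complex.neg_re, Complex.neg_re]
  linarith

/-- The orientation determinant in the coordinates `Re (x * e)`, `Im (x * e)`, that is, relative to
the supporting line defined by `e`. -/
theorem norm_sq_mul_im_conj_mul (e x y : ℂ) :
    ‖e‖ ^ 2 * ((starRingEnd ℂ) x * y).im =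
      (x * e).re * (y * e).im - (x * e).im * (y * e).re := by
  rw [← Complex.normSq_eq_norm_sq, Complex.normSq_apply]
  simp
  ring

theorem convex_combination_lt {a b x y m : ℝ} (ha : 0 < a) (hb : 0 ≤ b) (hab : a + b = 1)
    (hx : x < m) (hy : y ≤ m) : a * x + b * y < m := by
  have h1 := mul_lt_mul_of_pos_left hx ha
  have h2 := mul_le_mul_of_nonneg_left hy hb
  have h3 : a * m + b * m = m := by rw [← add_mul, hab, one_mul]
  linarith

theorem convex_re_lt (e : ℂ) (m : ℝ) : Convex ℝ {x : ℂ | (x * e).re < m} := by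
  intro x hx y hy a b ha hb hab
  have hre : ((a • x + b • y) * e).re = a * (x * e).re + b * (y * e).re := by simp; ring
  simp only [mem_ofPred_eq] at hx hy ⊢
  rw [hre]
  rcases ha.eq_or_lt with h | h
  · have : b = 1 := by linarith
    rw [← h, this]; linarith
  · exact convex_combination_lt h hb hab hx hy.le

/-- A convex set that contains all vertices of the polygon when `p`, `q` are the only ones on the
supporting line; it then contains the polygon, which therefore meets this line only in the segment.
-/
theorem convex_re_lt_union_segment (e p q : ℂ) {m : ℝ} (hp : (p * e).re = m)
    (hq : (q * e).re = m) : Convex ℝ ({x : ℂ | (x * e).re < m} ∪ segment ℝ p q) := by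
  have hseg : ∀ x ∈ segment ℝ p q, (x * e).re = m := by
    rintro _ ⟨a, b, ha, hb, hab, rfl⟩
    have : ((a • p + b • q) * e).re = a * (p * e).re + b * (q * e).re := by simp; ring
    rw [this, hp, hq, ← add_mul, hab, one_mul]
  intro x hx y hy a b ha hb hab
  have hre : ((a • x + b • y) * e).re = a * (x * e).re + b * (y * e).re := by simp; ring
  rcases hx with hx | hx <;> rcases hy with hy | hy
  · exact Or.inl (convex_re_lt e m hx hy ha hb hab)
  · rcases ha.eq_or_lt with h | h
    · right
      have : b = 1 := by linarith
      rw [← h, this, zero_smul, one_smul, zero_add]; exact hy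
    · left
      simp only [mem_ofPred_eq] at hx ⊢
      rw [hre]
      exact convex_combination_lt h hb hab hx (hseg y hy).le
  · rcases hb.eq_or_lt with h | h
    · right
      have : a = 1 := by linarith
      rw [← h, this, zero_smul, one_smul, add_zero]; exact hx
    · left
      simp only [mem_ofPred_eq] at hy ⊢
      rw [hre, add_comm]
      exact convex_combination_lt h ha (by linarith) hy (hseg x hx).le
  · right
    exact convex_segment p q hx hy ha hb hab

/-- The vertices of a convex polygon on a supporting line belong to a common edge. -/
theorem IsCounterclockwise.exists_edge {ℓ : ℕ} {v : Fin ℓ → ℂ} (hv : IsCounterclockwise v) {e : ℂ}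
    (he : e ≠ 0) {m : ℝ} (hm : ∀ j, (v j * e).re ≤ m) (hex : ∃ j, (v j * e).re = m) :
    ∃ a, (v a * e).re = m ∧ ∀ j, (v j * e).re = m → j = a ∨ j = finRotate ℓ a := by
  have hpos : 0 < ‖e‖ ^ 2 := by positivity
  have hsub : ∀ i j, ((v i - v j) * e).re = (v i * e).re - (v j * e).re := fun i j => by
    rw [sub_mul, Complex.sub_re]
  -- For two non-adjacent vertices on the supporting line, the successor of each is on the lower
  -- side. The left-turn conditions at the two vertices then give opposite signs to the same
  -- imaginary part.
  have hadj : ∀ a b, (v a * e).re = m → (v b * e).re = m → a ≠ b →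
      b = finRotate ℓ a ∨ a = finRotate ℓ b := by
    intro a b ha hb hab
    by_contra! hcon
    have h1 := mul_pos hpos (hv.2 a b hab.symm hcon.1)
    have h2 := mul_pos hpos (hv.2 b a hab hcon.2)
    rw [norm_sq_mul_im_conj_mul, hsub, hsub, ha, hb, sub_self, mul_zero, sub_zero] at h1
    rw [norm_sq_mul_im_conj_mul, hsub, hsub, ha, hb, sub_self, mul_zero, sub_zero,
      ← neg_sub (v b), neg_mul, Complex.neg_im] at h2
    have h3 := hm (finRotate ℓ a)
    have h4 := hm (finRotate ℓ b)
    rcases le_total 0 ((v b - v a) * e).im with h | h <;> nlinarith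
  have hthird : ∀ a, (v a * e).re = m → (v (finRotate ℓ a) * e).re = m →
      ∀ j, (v j * e).re = m → j = a ∨ j = finRotate ℓ a := by
    intro a ha hra j hj
    by_contra! hcon
    have h1 := mul_pos hpos (hv.2 a j hcon.1 hcon.2)
    rw [norm_sq_mul_im_conj_mul, hsub, hsub, ha, hra, hj, sub_self] at h1
    simp at h1
  obtain ⟨a, ha⟩ := hex
  by_cases hone : ∃ b, (v b * e).re = m ∧ a ≠ b
  · obtain ⟨b, hb, hab⟩ := hone
    rcases hadj a b ha hb hab with h | h
    · exact ⟨a, ha, hthird a ha (h ▸ hb)⟩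
    · exact ⟨b, hb, hthird b hb (h ▸ ha)⟩
  · push Not at hone
    exact ⟨a, ha, fun j hj => Or.inl (hone j hj).symm⟩

/-- A point of a convex polygon which is on none of its edges is strictly below the maximum of each
nonzero linear functional. -/
theorem IsCounterclockwise.exists_re_mul_lt {ℓ k : ℕ} {v : Fin ℓ → ℂ} (hv : IsCounterclockwise v)
    {a : Fin k → ℂ} (hext : (convexHull ℝ (range a)).extremePoints ℝ = range v) {i : Fin k}
    (hi : ∀ j, a i ∉ segment ℝ (v j) (v (finRotate ℓ j))) {e : ℂ} (he : e ≠ 0) :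
    ∃ j, (a i * e).re < (v j * e).re := by
  by_contra! hcon
  have hcompact : IsCompact (convexHull ℝ (range a)) := (finite_range a).isCompact_convexHull ℝ
  -- By Krein–Milman the hull of all the `a i` is the hull of the vertices alone.
  have hkm := closure_convexHull_extremePoints hcompact (convex_convexHull ℝ _)
  rw [hext, ((finite_range v).isCompact_convexHull ℝ).isClosed.closure_eq] at hkm
  have hmem : a i ∈ convexHull ℝ (range v) := by
    rw [hkm]; exact subset_convexHull ℝ _ (mem_range_self i)
  by_cases hex : ∃ j, (v j * e).re = (a i * e).re
  · obtain ⟨b, hb, hedge⟩ := hv.exists_edge he hcon hex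
    by_cases hrb : (v (finRotate ℓ b) * e).re = (a i * e).re
    · have := convexHull_min (t := {x : ℂ | (x * e).re < (a i * e).re} ∪
        segment ℝ (v b) (v (finRotate ℓ b))) (by
          rintro _ ⟨j, rfl⟩
          rcases (hcon j).lt_or_eq with h | h
          · exact Or.inl h
          · rcases hedge j h with rfl | rfl
            · exact Or.inr (left_mem_segment ℝ _ _)
            · exact Or.inr (right_mem_segment ℝ _ _)) (convex_re_lt_union_segment e _ _ hb hrb) hmem
      rcases this with h | h
      · simp only [mem_ofPred_eq, lt_irrefl] at h
      · exact hi b h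
    · have := convexHull_min (t := {x : ℂ | (x * e).re < (a i * e).re} ∪
        segment ℝ (v b) (v b)) (by
          rintro _ ⟨j, rfl⟩
          rcases (hcon j).lt_or_eq with h | h
          · exact Or.inl h
          · rcases hedge j h with rfl | rfl
            · exact Or.inr (left_mem_segment ℝ _ _)
            · exact absurd h hrb) (convex_re_lt_union_segment e _ _ hb hb) hmem
      rcases this with h | h
      · simp only [mem_ofPred_eq, lt_irrefl] at h
      · rw [segment_same, mem_singleton_iff] at h
        exact hi b (h ▸ left_mem_segment ℝ _ _)
  · push Not at hex
    have := convexHull_min (t := {x : ℂ | (x * e).re < (a i * e).re}) (by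
      rintro _ ⟨j, rfl⟩
      exact lt_of_le_of_ne (hcon j) (hex j)) (convex_re_lt e _) hmem
    simp only [mem_ofPred_eq, lt_irrefl] at this

/-- The uniform version of the strict inequality `Re (a z) < max Re (vⱼ z)`. -/
theorem exists_pos_add_norm_le {ℓ : ℕ} {v : Fin ℓ → ℂ} {a : ℂ}
    (h : ∀ e : ℂ, e ≠ 0 → ∃ j, (a * e).re < (v j * e).re) :
    ∃ δ > 0, ∀ z : ℂ, z ≠ 0 → ∃ j, (a * z).re + δ * ‖z‖ ≤ (v j * z).re := by
  obtain ⟨j₀, -⟩ := h 1 one_ne_zero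
  have hne : (Finset.univ : Finset (Fin ℓ)).Nonempty := ⟨j₀, Finset.mem_univ _⟩
  set ψ : ℂ → ℝ := fun z => Finset.univ.sup' hne fun j => (v j * z).re - (a * z).re with hψ
  have hcont : Continuous ψ := by
    refine Continuous.finset_sup'_apply hne fun j _ => ?_
    fun_prop
  obtain ⟨z₀, hz₀, hmin⟩ := (isCompact_sphere (0 : ℂ) 1).exists_isMinOn
    ⟨1, by simp⟩ hcont.continuousOn
  have hz₀0 : z₀ ≠ 0 := by
    rintro rfl; simp at hz₀
  refine ⟨ψ z₀, ?_, fun z hz => ?_⟩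
  · obtain ⟨j, hj⟩ := h z₀ hz₀0
    exact (sub_pos.2 hj).trans_le (Finset.le_sup' (fun j => (v j * z₀).re - (a * z₀).re)
      (Finset.mem_univ j))
  · have hnz : 0 < ‖z‖ := norm_pos_iff.2 hz
    set u := ‖z‖⁻¹ • z with hu
    have hus : u ∈ Metric.sphere (0 : ℂ) 1 := by
      rw [mem_sphere_zero_iff_norm, hu, norm_smul, norm_inv, norm_norm, inv_mul_cancel₀ hnz.ne']
    obtain ⟨j, -, hj⟩ := Finset.exists_mem_eq_sup' hne fun j => (v j * u).re - (a * u).re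
    refine ⟨j, ?_⟩
    have h1 : ψ z₀ ≤ (v j * u).re - (a * u).re := by rw [← hj]; exact hmin hus
    have h2 : ∀ w : ℂ, (w * u).re * ‖z‖ = (w * z).re := by
      intro w
      have : w * z = ‖z‖ • (w * u) := by
        rw [hu, mul_smul_comm, smul_smul, mul_inv_cancel₀ hnz.ne', one_smul]
      rw [this, Complex.smul_re, smul_eq_mul, mul_comm]
    have h3 := mul_le_mul_of_nonneg_right h1 hnz.le
    rw [sub_mul, h2, h2] at h3
    linarith

end SubharmonicConfiguration

/-! ### Lower bound at a vertex; radial comparison off the edges -/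

namespace SubharmonicConfiguration

/-- The open convex cone generated by the disc of centre `e` and radius `τ`. -/
def discCone (e : ℂ) (τ : ℝ) : Set ℂ := {x | ∃ t : ℝ, 0 < t ∧ ‖x - t • e‖ < τ * t}

theorem isOpen_discCone (e : ℂ) (τ : ℝ) : IsOpen (discCone e τ) := by
  have : discCone e τ = ⋃ t ∈ Ioi (0 : ℝ), Metric.ball (t • e) (τ * t) := by
    ext x; simp [discCone, dist_eq_norm]
  rw [this]
  exact isOpen_biUnion fun t _ => Metric.isOpen_ball

theorem convex_discCone (e : ℂ) (τ : ℝ) : Convex ℝ (discCone e τ) := by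
  rintro x ⟨t, ht, hx⟩ y ⟨u, hu, hy⟩ a b ha hb hab
  have hpos : 0 < a * t + b * u := by
    rcases ha.eq_or_lt with h | h
    · have : b = 1 := by linarith
      rw [← h, this]; linarith
    · have := mul_pos h ht
      have := mul_nonneg hb hu.le
      linarith
  refine ⟨a * t + b * u, hpos, ?_⟩
  have h1 : a • x + b • y - (a * t + b * u) • e = a • (x - t • e) + b • (y - u • e) := by
    module
  rw [h1]
  refine (norm_add_le _ _).trans_lt ?_
  rw [norm_smul, norm_smul, Real.norm_of_nonneg ha, Real.norm_of_nonneg hb]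
  rcases ha.eq_or_lt with h | h
  · have : b = 1 := by linarith
    rw [← h, this]; linarith
  · have h2 := mul_lt_mul_of_pos_left hx h
    have h3 := mul_le_mul_of_nonneg_left hy.le hb
    linarith

theorem hasDerivAt_segment (p y : ℂ) (s : ℝ) :
    HasDerivAt (fun s : ℝ => p + s • (y - p)) (y - p) s := by
  simpa using ((hasDerivAt_id s).smul_const (y - p)).const_add p

variable {R : ℝ} {V : ℂ → EReal} {k : ℕ} {g : Fin k → ℂ → ℂ} {H : Fin k → ℂ → ℝ}

theorem hasDerivAt_harmonic_segment
    (hH : ∀ i, InnerProductSpace.HarmonicOnNhd (H i) (Metric.ball 0 R))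
    (hHg : ∀ i, ∀ z ∈ Metric.ball (0 : ℂ) R, dz (H i) z = g i z) (i : Fin k) (p y : ℂ) {s : ℝ}
    (hs : p + s • (y - p) ∈ Metric.ball (0 : ℂ) R) :
    HasDerivAt (fun s : ℝ => H i (p + s • (y - p)))
      (2 * (g i (p + s • (y - p)) * (y - p)).re) s := by
  have hd : HasFDerivAt (H i) (fderiv ℝ (H i) (p + s • (y - p))) (p + s • (y - p)) :=
    ((hH i _ hs).1.differentiableAt (by norm_num)).hasFDerivAt
  have := hd.comp_hasDerivAt s (hasDerivAt_segment p y s)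
  rwa [fderiv_apply_eq_re_dz_mul, hHg i _ hs] at this

theorem exists_lipschitz_harmonic
    (hH : ∀ i, InnerProductSpace.HarmonicOnNhd (H i) (Metric.ball 0 R)) {r : ℝ} (hr : r < R) :
    ∃ L : ℝ, 0 ≤ L ∧ ∀ i, ∀ z ∈ Metric.ball (0 : ℂ) r, ∀ w ∈ Metric.ball (0 : ℂ) r,
      |H i z - H i w| ≤ L * ‖z - w‖ := by
  obtain ⟨L, hL, h⟩ := exists_norm_fderiv_le hH hr
  refine ⟨L, hL, fun i z hz w hw => ?_⟩
  refine (convex_ball (0 : ℂ) r).norm_image_sub_le_of_norm_fderiv_le (𝕜 := ℝ) (f := H i)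
    (fun x hx => ?_) (fun x hx => h i x (Metric.ball_subset_closedBall hx)) hw hz
  exact (hH i x (Metric.ball_subset_ball hr.le hx)).1.differentiableAt (by norm_num)

/-- If `gⱼ(0)` is strictly exposed among `g₁(0), …, g_k(0)` and the origin is in the closure of the
set where `gⱼ` is active, then `V ≥ Hⱼ + V(0)` near the origin, with equality where `gⱼ` is
active. -/
theorem eventually_harmonic_le (hV : IsSH₀ (disc R) V)
    (hg : IsPiecewiseHolomorphicDz (disc R) V g)
    (hH : ∀ i, InnerProductSpace.HarmonicOnNhd (H i) (Metric.ball 0 R))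
    (hHg : ∀ i, ∀ z ∈ Metric.ball (0 : ℂ) R, dz (H i) z = g i z) (hH0 : ∀ i, H i 0 = 0)
    {ρ L : ℝ} (hρ : 0 < ρ) (hρR : ρ < R) (hL : 0 ≤ L) {f : ℂ → ℝ}
    (hVf : ∀ z ∈ Metric.ball (0 : ℂ) ρ, V z = f z)
    (hf : ∀ z ∈ Metric.ball (0 : ℂ) ρ, ∀ w ∈ Metric.ball (0 : ℂ) ρ, |f z - f w| ≤ L * ‖z - w‖)
    {j : Fin k} {e : ℂ} (he : ∀ i, i ≠ j → (g i 0 * e).re < (g j 0 * e).re)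
    (hj : (0 : ℂ) ∈ closure (activeSet (disc R) V (g j))) :
    ∀ᶠ z in 𝓝 (0 : ℂ), H j z + f 0 ≤ f z ∧
      (z ∈ activeSet (disc R) V (g j) → f z = H j z + f 0) := by
  have hS := hV.isSubharmonic
  have hR : 0 < R := hρ.trans hρR
  have hgc : ∀ i, ContinuousAt (g i) 0 := fun i =>
    (hg.holomorphic i).continuousOn.continuousAt (Metric.ball_mem_nhds 0 hR)
  have hev : ∀ᶠ q : ℂ × ℂ in 𝓝 ((0 : ℂ), e), ∀ i, i ≠ j →
      (g i q.1 * q.2).re < (g j q.1 * q.2).re := by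
    rw [eventually_all]
    intro i
    by_cases hij : i = j
    · exact Eventually.of_forall fun q h => absurd hij h
    have hc : ∀ i, ContinuousAt (fun q : ℂ × ℂ => (g i q.1 * q.2).re) ((0 : ℂ), e) := fun i => by
      have h1 : ContinuousAt (fun q : ℂ × ℂ => g i q.1) ((0 : ℂ), e) :=
        ContinuousAt.comp (f := Prod.fst) (hgc i) continuousAt_fst
      exact Complex.continuous_re.continuousAt.comp (h1.mul continuousAt_snd)
    filter_upwards [(hc i).eventually_lt (hc j) (he i hij)] with q hq _
    exact hq
  obtain ⟨τ, hτ, hball⟩ := Metric.eventually_nhds_iff_ball.1 hev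
  -- Strict exposure persists for points near the origin and directions near `e`, and by homogeneity
  -- for all directions of the cone.
  have hneg : ∀ z, ‖z‖ < τ → ∀ x ∈ discCone e τ, ∀ i, 2 * (g i z * x).re - 2 * (g j z * x).re ≤ 0 := by
    rintro z hz x ⟨t, ht, hx⟩ i
    by_cases hij : i = j
    · rw [hij, sub_self]
    have hmem : ((z, t⁻¹ • x) : ℂ × ℂ) ∈ Metric.ball ((0 : ℂ), e) τ := by
      rw [Metric.mem_ball, Prod.dist_eq, max_lt_iff, dist_zero_right, dist_eq_norm]
      refine ⟨hz, ?_⟩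
      have : t⁻¹ • x - e = t⁻¹ • (x - t • e) := by
        rw [smul_sub, smul_smul, inv_mul_cancel₀ ht.ne', one_smul]
      rw [this, norm_smul, norm_inv, Real.norm_of_nonneg ht.le, inv_mul_lt_iff₀ ht, mul_comm]
      exact hx
    have h1 := hball _ hmem i hij
    simp only [mul_smul_comm, Complex.smul_re, smul_eq_mul] at h1
    have := lt_of_mul_lt_mul_left h1 (inv_nonneg.2 ht.le)
    linarith
  set σ := min τ ρ with hσ
  have hσ0 : 0 < σ := lt_min hτ hρ
  have hσρ : Metric.ball (0 : ℂ) σ ⊆ Metric.ball 0 ρ := Metric.ball_subset_ball (min_le_right _ _)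
  have hσR : Metric.ball (0 : ℂ) σ ⊆ Metric.ball 0 R :=
    hσρ.trans (Metric.ball_subset_ball hρR.le)
  obtain ⟨L', hL', hHL⟩ := exists_lipschitz_harmonic hH hρR
  have hWL : ∀ z ∈ Metric.ball (0 : ℂ) σ, ∀ w ∈ Metric.ball (0 : ℂ) σ,
      |(f z - H j z) - (f w - H j w)| ≤ (L + L') * ‖z - w‖ := by
    intro z hz w hw
    have h1 := abs_le.1 (hf z (hσρ hz) w (hσρ hw))
    have h2 := abs_le.1 (hHL j z (hσρ hz) w (hσρ hw))
    rw [abs_le]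
    constructor <;> linarith
  have hdec : ∀ p ∈ Metric.ball (0 : ℂ) σ, ∀ y ∈ Metric.ball (0 : ℂ) σ, y - p ∈ discCone e τ →
      f y - H j y ≤ f p - H j p := by
    intro p hp y hy hyp
    have hO : IsOpen (Metric.ball (0 : ℂ) σ ∩ (fun y => y - p) ⁻¹' discCone e τ) :=
      Metric.isOpen_ball.inter ((isOpen_discCone e τ).preimage (by fun_prop))
    refine le_of_deriv_segment_nonpos (f := fun z => f z - H j z) (by linarith) hWL
      hV.volume_suppLaplacian hp hO inter_subset_left ?_ y ⟨hy, hyp⟩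
    rintro y ⟨hy, hyp⟩ s hs hsK d hd
    have hmem : p + s • (y - p) ∈ Metric.ball (0 : ℂ) σ :=
      (convex_ball (0 : ℂ) σ).add_smul_sub_mem hp hy (Ioo_subset_Icc_self hs)
    obtain ⟨i, hi⟩ := hg.exists_eq _ ⟨hσR hmem, hsK⟩
    obtain ⟨r, hr, c, hVH⟩ := exists_ball_of_mem_activeSet hS (hH i) (hHg i) ⟨⟨hσR hmem, hsK⟩, hi⟩
    have hd' : HasDerivAt (fun s : ℝ => (H i (p + s • (y - p)) + c) - H j (p + s • (y - p)))
        (2 * (g i (p + s • (y - p)) * (y - p)).re - 2 * (g j (p + s • (y - p)) * (y - p)).re) s :=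
      ((hasDerivAt_harmonic_segment hH hHg i p y (hσR hmem)).add_const c).sub
        (hasDerivAt_harmonic_segment hH hHg j p y (hσR hmem))
    have heq : (fun s : ℝ => f (p + s • (y - p)) - H j (p + s • (y - p))) =ᶠ[𝓝 s]
        fun s : ℝ => (H i (p + s • (y - p)) + c) - H j (p + s • (y - p)) := by
      have hc : ContinuousAt (fun s : ℝ => p + s • (y - p)) s :=
        (hasDerivAt_segment p y s).continuousAt
      filter_upwards [hc (Metric.ball_mem_nhds _ hr),
        hc (Metric.isOpen_ball.mem_nhds (hσρ hmem))] with t ht1 ht2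
      have := hVH _ ht1
      rw [hVf _ ht2, EReal.coe_eq_coe_iff] at this
      rw [this]
    rw [(hd'.congr_of_eventuallyEq heq).unique hd |>.symm]
    refine hneg _ ?_ _ hyp i
    rw [mem_ball_zero_iff] at hmem
    exact hmem.trans_le (min_le_left _ _)
  have hfc : ContinuousOn f (Metric.ball 0 ρ) := by
    have : LipschitzOnWith (Real.toNNReal L) f (Metric.ball 0 ρ) := by
      refine LipschitzOnWith.of_dist_le_mul fun z hz w hw => ?_
      rw [Real.coe_toNNReal _ hL, Real.dist_eq, dist_eq_norm]
      exact hf z hz w hw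
    exact this.continuousOn
  -- Chosen so that `2σ' = τ * T`, which puts `z₀ + T • e` in the cone issued from any `z` with
  -- `‖z‖, ‖z₀‖ < σ'`, and so that `σ' + T * ‖e‖ = σ / 2`, which keeps that point in the disc of
  -- radius `σ`.
  set T := σ / (τ + 2 * ‖e‖) with hT
  have hden : 0 < τ + 2 * ‖e‖ := by positivity
  have hT0 : 0 < T := by positivity
  have hTσ : T * (τ + 2 * ‖e‖) = σ := by rw [hT]; field_simp
  set σ' := τ * T / 2 with hσ'
  have hσ'0 : 0 < σ' := by positivity
  have hσ'σ : σ' + T * ‖e‖ < σ := by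
    have : σ' + T * ‖e‖ = σ / 2 := by rw [hσ', ← hTσ]; ring
    rw [this]; linarith
  have hTe : 0 ≤ T * ‖e‖ := by positivity
  have hkey : ∀ z₀ ∈ activeSet (disc R) V (g j), ‖z₀‖ < σ' → ∀ z : ℂ, ‖z‖ < σ' →
      f z₀ - H j z₀ ≤ f z - H j z := by
    intro z₀ hz₀ hz₀n z hzn
    have hz₀σ : z₀ ∈ Metric.ball (0 : ℂ) σ := by rw [mem_ball_zero_iff]; linarith
    have hzσ : z ∈ Metric.ball (0 : ℂ) σ := by rw [mem_ball_zero_iff]; linarith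
    obtain ⟨r, hr, c, hVH⟩ := exists_ball_of_mem_activeSet hS (hH j) (hHg j) hz₀
    have hnear : ∀ᶠ s in 𝓝 (0 : ℝ), z₀ - s • e ∈ Metric.ball z₀ r ∩ Metric.ball 0 σ := by
      have hc : ContinuousAt (fun s : ℝ => z₀ - s • e) 0 := by fun_prop
      refine hc.eventually_mem ?_
      simp only [zero_smul, sub_zero]
      exact inter_mem (Metric.ball_mem_nhds z₀ hr) (Metric.isOpen_ball.mem_nhds hz₀σ)
    obtain ⟨s, ⟨hsr, hsσ⟩, hs0⟩ :=
      ((hnear.filter_mono (nhdsWithin_le_nhds (s := Ioi 0))).and self_mem_nhdsWithin).exists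
    -- The apex is moved slightly back so that `z₀` is an interior point of the cone from `p`. On
    -- the cone `f - H j ≤ c`, with equality at `z₀`, so the strong maximum principle applies.
    set p := z₀ - s • e with hp
    have hWc : ∀ w ∈ Metric.ball z₀ r, w ∈ Metric.ball (0 : ℂ) σ → f w - H j w = c := by
      intro w hw hwσ
      have := hVH w hw
      rw [hVf w (hσρ hwσ), EReal.coe_eq_coe_iff] at this
      rw [this]; ring
    have hpc := hWc p hsr hsσ
    have hz₀c := hWc z₀ (Metric.mem_ball_self hr) hz₀σ
    set O := Metric.ball (0 : ℂ) σ ∩ (fun y => y - p) ⁻¹' discCone e τ with hO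
    have hOo : IsOpen O :=
      Metric.isOpen_ball.inter ((isOpen_discCone e τ).preimage (by fun_prop))
    have hOc : Convex ℝ O := by
      refine (convex_ball (0 : ℂ) σ).inter ?_
      intro x hx y hy a b ha hb hab
      have : a • x + b • y - p = a • (x - p) + b • (y - p) := by
        conv_lhs => rw [← one_smul ℝ p, ← hab]
        module
      rw [mem_preimage, this]
      exact convex_discCone e τ hx hy ha hb hab
    have hz₀O : z₀ ∈ O := by
      refine ⟨hz₀σ, s, hs0, ?_⟩
      simp only [hp, sub_sub_cancel, sub_self, norm_zero]
      positivity
    have hconst := hS.eq_of_isMax (ρ := ρ) hρR.le hVf hfc (hH j) hOo hOc.isPreconnected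
      (inter_subset_left.trans hσρ) (c := c)
      (fun y hy => (hdec p hsσ y hy.1 hy.2).trans hpc.le) hz₀O hz₀c
    set y := z₀ + T • e with hy
    have hyσ : y ∈ Metric.ball (0 : ℂ) σ := by
      rw [mem_ball_zero_iff]
      have := norm_add_le z₀ (T • e)
      rw [norm_smul, Real.norm_of_nonneg hT0.le] at this
      linarith
    have hyO : y ∈ O := by
      refine ⟨hyσ, T + s, by linarith, ?_⟩
      have : y - p - (T + s) • e = 0 := by rw [hy, hp]; module
      rw [this, norm_zero]
      exact mul_pos hτ (by linarith)
    have hyz : y - z ∈ discCone e τ := by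
      refine ⟨T, hT0, ?_⟩
      have h1 : y - z - T • e = z₀ - z := by rw [hy]; module
      rw [h1]
      have := norm_sub_le z₀ z
      have h2 : τ * T = σ' + σ' := by rw [hσ']; ring
      linarith
    rw [hz₀c, ← hconst y hyO]
    exact hdec z hzσ y hyσ hyz
  -- Every active point near the origin minimises `f - H j`; continuity passes this to the origin, a
  -- limit of active points.
  have hW0 : ∀ z : ℂ, ‖z‖ < σ' → f 0 - H j 0 ≤ f z - H j z := by
    intro z hz
    have hne : NeBot (𝓝[activeSet (disc R) V (g j)] (0 : ℂ)) :=
      mem_closure_iff_nhdsWithin_neBot.1 hj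
    have hcont : ContinuousAt (fun w => f w - H j w) 0 :=
      (hfc.continuousAt (Metric.ball_mem_nhds 0 hρ)).sub
        (hH j 0 (Metric.mem_ball_self hR)).1.continuousAt
    refine le_of_tendsto (hcont.tendsto.mono_left
      (nhdsWithin_le_nhds (s := activeSet (disc R) V (g j)))) ?_
    filter_upwards [self_mem_nhdsWithin,
      mem_nhdsWithin_of_mem_nhds (Metric.ball_mem_nhds (0 : ℂ) hσ'0)] with w hw1 hw2
    exact hkey w hw1 (by simpa using hw2) z hz
  filter_upwards [Metric.ball_mem_nhds (0 : ℂ) hσ'0] with z hz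
  rw [mem_ball_zero_iff] at hz
  have h1 := hW0 z hz
  rw [hH0] at h1
  refine ⟨by linarith, fun hact => ?_⟩
  have h2 := hkey z hact hz 0 (by simpa using hσ'0)
  rw [hH0] at h2
  linarith

/-- If `gᵢ(0)` is in the interior of the polygon then, near the origin, the radial derivative of `Hᵢ`
is at most that of the largest of the functions `Hⱼ`. -/
theorem eventually_radial_le {ι : Type*} [Finite ι] (hR : 0 < R)
    (hgc : ∀ i, ContinuousAt (g i) 0)
    (hH : ∀ i, InnerProductSpace.HarmonicOnNhd (H i) (Metric.ball 0 R))
    (hHg : ∀ i, ∀ z ∈ Metric.ball (0 : ℂ) R, dz (H i) z = g i z) (hH0 : ∀ i, H i 0 = 0)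
    {v : ι → Fin k} {i : Fin k} {δ : ℝ} (hδ : 0 < δ)
    (h : ∀ z : ℂ, z ≠ 0 → ∃ j, (g i 0 * z).re + δ * ‖z‖ ≤ (g (v j) 0 * z).re) :
    ∀ᶠ z in 𝓝 (0 : ℂ), ∀ m, (∀ j, H (v j) z ≤ H (v m) z) → (g i z * z).re ≤ (g (v m) z * z).re := by
  -- With `δ / 3` the errors add up exactly to `δ`: `δ / 3` from each of the two derivatives and `δ
  -- / 6` from each of the two values, as `H i z` is close to twice `Re (g i 0 * z)`.
  have hη : 0 < δ / 3 := by positivity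
  have hg' : ∀ᶠ z in 𝓝 (0 : ℂ), ∀ i, ‖g i z - g i 0‖ ≤ δ / 3 := by
    rw [eventually_all]
    intro i
    have := (hgc i).eventually (Metric.closedBall_mem_nhds _ hη)
    filter_upwards [this] with z hz
    rwa [← dist_eq_norm]
  have hH' : ∀ᶠ z in 𝓝 (0 : ℂ), ∀ i, |H i z - 2 * (g i 0 * z).re| ≤ δ / 3 * ‖z‖ := by
    rw [eventually_all]
    intro i
    have hd : HasFDerivAt (H i) (fderiv ℝ (H i) 0) 0 :=
      ((hH i 0 (Metric.mem_ball_self hR)).1.differentiableAt (by norm_num)).hasFDerivAt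
    have := hd.isLittleO.def hη
    filter_upwards [this] with z hz
    rwa [hH0, sub_zero, sub_zero, fderiv_apply_eq_re_dz_mul, hHg i 0 (Metric.mem_ball_self hR)] at hz
  filter_upwards [hg', hH'] with z h1 h2 m hm
  by_cases hz : z = 0
  · simp [hz]
  obtain ⟨j, hj⟩ := h z hz
  have hdiff : ∀ i, |(g i z * z).re - (g i 0 * z).re| ≤ δ / 3 * ‖z‖ := by
    intro i
    rw [← Complex.sub_re, ← sub_mul]
    refine (Complex.abs_re_le_norm _).trans ?_
    rw [norm_mul]
    exact mul_le_mul_of_nonneg_right (h1 i) (norm_nonneg _)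
  have e1 := abs_le.1 (hdiff i)
  have e2 := abs_le.1 (hdiff (v m))
  have e3 := abs_le.1 (h2 (v j))
  have e4 := abs_le.1 (h2 (v m))
  have e5 := hm j
  have hz0 := norm_nonneg z
  nlinarith

theorem abs_sup'_sub_sup'_le {ι : Type*} {s : Finset ι} (hs : s.Nonempty) {a b : ι → ℝ} {c : ℝ}
    (h : ∀ i ∈ s, |a i - b i| ≤ c) : |s.sup' hs a - s.sup' hs b| ≤ c := by
  rw [abs_le]
  constructor
  · have : s.sup' hs b ≤ s.sup' hs a + c := Finset.sup'_le hs _ fun i hi => by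
      have := (abs_le.1 (h i hi)).1
      linarith [Finset.le_sup' a hi]
    linarith
  · have : s.sup' hs a ≤ s.sup' hs b + c := Finset.sup'_le hs _ fun i hi => by
      have := (abs_le.1 (h i hi)).2
      linarith [Finset.le_sup' b hi]
    linarith

end SubharmonicConfiguration

/-! ### Proof of the theorem -/

open SubharmonicConfiguration in
theorem mainTheorem5 (R : ℝ) (hR : 0 < R) (V : ℂ → EReal)
    (hV : SubharmonicConfiguration.IsSH₀ (SubharmonicConfiguration.disc R) V)
    (k ℓ : ℕ) (hℓ : 1 ≤ ℓ) (hℓk : ℓ ≤ k) (g : Fin k → ℂ → ℂ)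
    (hg : SubharmonicConfiguration.IsPiecewiseHolomorphicDz (SubharmonicConfiguration.disc R) V g)
    (H : Fin k → ℂ → ℝ)
    (hH : ∀ i, InnerProductSpace.HarmonicOnNhd (H i) (Metric.ball 0 R))
    (hHg : ∀ i, ∀ z ∈ Metric.ball (0 : ℂ) R, SubharmonicConfiguration.dz (H i) z = g i z)
    (hH0 : ∀ i, H i 0 = 0)
    (hext : (convexHull ℝ (Set.range fun i => g i 0)).extremePoints ℝ =
      Set.range fun j : Fin ℓ => g (Fin.castLE hℓk j) 0)
    (hccw : SubharmonicConfiguration.IsCounterclockwise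
      fun j : Fin ℓ => g (Fin.castLE hℓk j) 0)
    (hactive : ∀ j : Fin ℓ, (0 : ℂ) ∈ closure (SubharmonicConfiguration.activeSet
      (SubharmonicConfiguration.disc R) V (g (Fin.castLE hℓk j))))
    (hedge : ∀ i : Fin k, ℓ ≤ (i : ℕ) → ∀ j : Fin ℓ,
      g i 0 ∉ segment ℝ (g (Fin.castLE hℓk j) 0) (g (Fin.castLE hℓk (finRotate ℓ j)) 0)) :
    ∃ c : ℝ, ∀ᶠ z in nhds (0 : ℂ),
      V z = (((Finset.univ.sup' (Finset.univ_nonempty_iff.mpr ⟨(⟨0, hℓ⟩ : Fin ℓ)⟩)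
        fun j : Fin ℓ => H (Fin.castLE hℓk j) z) + c : ℝ) : EReal) := by
  have hS := hV.isSubharmonic
  obtain ⟨ρ, hρ, hρR, L, hL, f, hVf, hf⟩ := exists_lipschitz hR hV hg hH hHg
  set v : Fin ℓ → Fin k := Fin.castLE hℓk with hv
  set M : ℂ → ℝ := fun z => Finset.univ.sup' (Finset.univ_nonempty_iff.mpr ⟨(⟨0, hℓ⟩ : Fin ℓ)⟩)
    fun j : Fin ℓ => H (v j) z with hM
  have hvi : ∀ i : Fin k, (i : ℕ) < ℓ → ∃ j, v j = i := fun i hi => ⟨⟨i, hi⟩, Fin.ext rfl⟩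
  have hgc : ∀ i, ContinuousAt (g i) 0 := fun i =>
    (hg.holomorphic i).continuousOn.continuousAt (Metric.ball_mem_nhds 0 hR)
  have hlower : ∀ᶠ z in 𝓝 (0 : ℂ), ∀ j, H (v j) z + f 0 ≤ f z ∧
      (z ∈ activeSet (disc R) V (g (v j)) → f z = H (v j) z + f 0) := by
    rw [eventually_all]
    intro j
    -- An extreme value is not repeated: among the first `ℓ` indices by injectivity, among the
    -- others because vertices lie on edges.
    have hne : ∀ i, i ≠ v j → g i 0 ≠ g (v j) 0 := by
      intro i hi heq
      rcases lt_or_ge (i : ℕ) ℓ with hiℓ | hiℓ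
      · obtain ⟨j', rfl⟩ := hvi i hiℓ
        exact hi (congrArg v (hccw.1 heq))
      · exact hedge i hiℓ j (heq ▸ left_mem_segment ℝ _ _)
    obtain ⟨e, he⟩ := exists_re_mul_lt_of_mem_extremePoints (a := fun i => g i 0) (j := v j)
      (hext ▸ mem_range_self j) hne
    exact eventually_harmonic_le hV hg hH hHg hH0 hρ hρR hL hVf hf he (hactive j)
  have hradial : ∀ᶠ z in 𝓝 (0 : ℂ), ∀ i : Fin k, ℓ ≤ (i : ℕ) → ∀ m,
      (∀ j, H (v j) z ≤ H (v m) z) → (g i z * z).re ≤ (g (v m) z * z).re := by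
    rw [eventually_all]
    intro i
    by_cases hi : ℓ ≤ (i : ℕ)
    · obtain ⟨δ, hδ, h⟩ := exists_pos_add_norm_le (v := fun j => g (v j) 0) (a := g i 0)
        fun e he => hccw.exists_re_mul_lt (a := fun i => g i 0) hext (hedge i hi) he
      filter_upwards [eventually_radial_le hR hgc hH hHg hH0 hδ h] with z hz _
      exact hz
    · exact Eventually.of_forall fun z h => absurd h hi
  obtain ⟨σ₀, hσ₀, hball⟩ := Metric.eventually_nhds_iff_ball.1 (hlower.and hradial)
  set σ := min σ₀ ρ with hσ
  have hσ0 : 0 < σ := lt_min hσ₀ hρ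
  have hσρ : Metric.ball (0 : ℂ) σ ⊆ Metric.ball 0 ρ := Metric.ball_subset_ball (min_le_right _ _)
  have hσR : Metric.ball (0 : ℂ) σ ⊆ Metric.ball 0 R :=
    hσρ.trans (Metric.ball_subset_ball hρR.le)
  have hσb : Metric.ball (0 : ℂ) σ ⊆ Metric.ball 0 σ₀ := Metric.ball_subset_ball (min_le_left _ _)
  have hMf : ∀ z ∈ Metric.ball (0 : ℂ) σ, M z + f 0 ≤ f z := by
    intro z hz
    have : M z ≤ f z - f 0 := Finset.sup'_le _ _ fun j _ => by
      linarith [((hball z (hσb hz)).1 j).1]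
    linarith
  have hHM : ∀ j z, H (v j) z ≤ M z := fun j z =>
    Finset.le_sup' (fun j => H (v j) z) (Finset.mem_univ j)
  obtain ⟨L', hL', hHL⟩ := exists_lipschitz_harmonic hH hρR
  have hFL : ∀ z ∈ Metric.ball (0 : ℂ) σ, ∀ w ∈ Metric.ball (0 : ℂ) σ,
      |(f z - M z) - (f w - M w)| ≤ (L + L') * ‖z - w‖ := by
    intro z hz w hw
    have h1 := abs_le.1 (hf z (hσρ hz) w (hσρ hw))
    have h2 : |M z - M w| ≤ L' * ‖z - w‖ :=
      abs_sup'_sub_sup'_le _ fun j _ => hHL (v j) z (hσρ hz) w (hσρ hw)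
    rw [abs_le] at h2 ⊢
    constructor <;> linarith
  have h0σ : (0 : ℂ) ∈ Metric.ball (0 : ℂ) σ := Metric.mem_ball_self hσ0
  have hM0 : M 0 = 0 := by simp [hM, hH0]
  -- It suffices that `f - M` has nonpositive derivative along rays from the origin, off the support
  -- of the Laplacian.
  have hupper : ∀ y ∈ Metric.ball (0 : ℂ) σ, f y - M y ≤ f 0 - M 0 := by
    refine le_of_deriv_segment_nonpos (f := fun z => f z - M z) (by linarith) hFL
      hV.volume_suppLaplacian h0σ Metric.isOpen_ball Subset.rfl ?_
    intro y hy s hs hsK d hd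
    set z := (0 : ℂ) + s • (y - 0) with hz
    have hzs : z = s • y := by rw [hz]; simp
    have hmem : z ∈ Metric.ball (0 : ℂ) σ :=
      (convex_ball (0 : ℂ) σ).add_smul_sub_mem h0σ hy (Ioo_subset_Icc_self hs)
    have hzD : z ∈ (disc R : Set ℂ) \ suppLaplacian (disc R) V := ⟨hσR hmem, hsK⟩
    obtain ⟨i, hi⟩ := hg.exists_eq z hzD
    obtain ⟨r, hr, c, hVH⟩ := exists_ball_of_mem_activeSet hS (hH i) (hHg i) ⟨hzD, hi⟩
    have hcont : ContinuousAt (fun s : ℝ => (0 : ℂ) + s • (y - 0)) s :=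
      (hasDerivAt_segment 0 y s).continuousAt
    have hnear : ∀ᶠ t in 𝓝 s, f ((0 : ℂ) + t • (y - 0)) = H i ((0 : ℂ) + t • (y - 0)) + c ∧
        (0 : ℂ) + t • (y - 0) ∈ Metric.ball (0 : ℂ) σ := by
      filter_upwards [hcont (Metric.ball_mem_nhds z hr),
        hcont (Metric.isOpen_ball.mem_nhds hmem)] with t ht1 ht2
      have := hVH _ ht1
      rw [hVf _ (hσρ ht2), EReal.coe_eq_coe_iff] at this
      exact ⟨this, ht2⟩
    have hat : f z = H i z + c := hnear.self_of_nhds.1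
    rcases lt_or_ge (i : ℕ) ℓ with hiℓ | hiℓ
    · obtain ⟨j, rfl⟩ := hvi i hiℓ
      have hc : c = f 0 := by
        have := ((hball z (hσb hmem)).1 j).2 ⟨hzD, hi⟩
        linarith
      -- Here `f = H (v j) + f 0 ≤ M + f 0 ≤ f` near `z`, so `f - M` is locally constant along the
      -- ray.
      have heq : (fun t : ℝ => f ((0 : ℂ) + t • (y - 0)) - M ((0 : ℂ) + t • (y - 0))) =ᶠ[𝓝 s]
          fun _ => f 0 := by
        filter_upwards [hnear] with t ht
        have h1 := hMf _ ht.2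
        have h2 := hHM j ((0 : ℂ) + t • (y - 0))
        linarith [ht.1]
      exact (((hasDerivAt_const s (f 0)).congr_of_eventuallyEq heq).unique hd).symm.le
    · obtain ⟨m, -, hm⟩ := Finset.exists_mem_eq_sup'
        (Finset.univ_nonempty_iff.mpr ⟨(⟨0, hℓ⟩ : Fin ℓ)⟩) fun j : Fin ℓ => H (v j) z
      have hmz : M z = H (v m) z := hm
      have hrad := (hball z (hσb hmem)).2 i hiℓ m fun j => hmz ▸ hHM j z
      have hd1 : HasDerivAt (fun t : ℝ => H i ((0 : ℂ) + t • (y - 0)) + c -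
          H (v m) ((0 : ℂ) + t • (y - 0)))
          (2 * (g i z * (y - 0)).re - 2 * (g (v m) z * (y - 0)).re) s :=
        ((hasDerivAt_harmonic_segment hH hHg i 0 y (hσR hmem)).add_const c).sub
          (hasDerivAt_harmonic_segment hH hHg (v m) 0 y (hσR hmem))
      -- `M` need not be differentiable, but this function is `M - H (v m)`, nonnegative and zero at
      -- `z`. Its derivative is zero, so `d` equals the derivative of `H i - H (v m)`, whose sign is
      -- known from `hrad`.
      have hmin : IsLocalMin (fun t : ℝ => H i ((0 : ℂ) + t • (y - 0)) + c -
          H (v m) ((0 : ℂ) + t • (y - 0)) -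
          (f ((0 : ℂ) + t • (y - 0)) - M ((0 : ℂ) + t • (y - 0)))) s := by
        filter_upwards [hnear] with t ht
        have h2 := hHM m ((0 : ℂ) + t • (y - 0))
        change H i z + c - H (v m) z - (f z - M z) ≤ _
        linarith [ht.1]
      have hzero := hmin.hasDerivAt_eq_zero (hd1.sub hd)
      rw [hzs] at hrad
      simp only [mul_smul_comm, Complex.smul_re, smul_eq_mul] at hrad
      have := le_of_mul_le_mul_left hrad hs.1
      rw [hzs, sub_zero] at hzero
      linarith
  refine ⟨f 0, ?_⟩
  filter_upwards [Metric.ball_mem_nhds (0 : ℂ) hσ0] with z hz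
  rw [hVf z (hσρ hz), EReal.coe_eq_coe_iff]
  have h1 := hupper z hz
  have h2 := hMf z hz
  rw [hM0] at h1
  change f z = M z + f 0
  linarith
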